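/- Let $E$ be the edge set of an oriented graph with a countable vertex set. For $p\in[0,1]$ let $\mathbb P_p$ be the product law on $\{0,1\}^E$ under which the edges are independently open (state $1$) with probability $p$ and closed (state $0$) otherwise. Let $C_+(x)$ be the (random) set of vertices that can be reached from $x$ by a finite, possibly empty, oriented path of open edges. Let $\overrightarrow{p_c}(2)$ be the critical value of classical oriented bond percolation on $\mathbb Z_+^2$, that is, the infimum of the $p\in(0,1]$ such that $\mathbb P_p(C_+(0)\text{ is infinite})>0$ for the graph on $\mathbb Z_+^2$ whose edges go from each $(a,b)$ to $(a+1,b)$ and to $(a,b+1)$. For an integer $M\ge 1$, consider the oriented graph on $\mathbb Z^2$ whose edges are the pairs $(x,y)$ with $y-x\in \mathrm{Dir}$, where $$\mathrm{Dir}=\{(0,-1)\}\cup\{(k,1): k\in\mathbb Z,\ |k|\le M\}.$$ For $u\in\mathbb R^2\setminus\{0\}$ put $$D_u(0)=\sup_{y\in C_+(0)}\langle y,u\rangle\in[0,+\infty],\qquad \theta_u(p)=\mathbb P_p(D_u(0)=+\infty),\qquad p_c(u)=\inf\{p\in(0,1]:\theta_u(p)>0\},$$ and let $(e_1,e_2)$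 be the canonical basis of $\mathbb R^2$. Then: - for every $M\ge 2$, $\displaystyle p_c(-e_2)\ge \frac1{2\sqrt{2M+1}}$; - for every $M\ge 5$, $\displaystyle p_c(e_2)\le 1-\bigl(1-\overrightarrow{p_c}(2)\bigr)^{2/M}<\frac{-2\ln\bigl(1-\overrightarrow{p_c}(2)\bigr)}{M}\le\frac{2\ln 3}{M}$; - for every $M\ge 37$, $p_c(e_2)<p_c(-e_2)$. -/

import Mathlib

/-! Independent bond percolation on oriented graphs, and the critical parameters of the example. -/

namespace OrientedPercolation

section General

variable {V : Type*}

/-- A configuration on the oriented graph with edge set `E`: `true` is open, `false` is closed. -/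
abbrev Config (E : Set (V × V)) : Type _ := E → Bool

/-- The law `Ber(p)^{⊗ E}` under which the edges are independently open with probability `p`. -/
noncomputable def law (E : Set (V × V)) (p : unitInterval) : MeasureTheory.Measure (Config E) :=
  MeasureTheory.Measure.infinitePi
    fun _ : E => ProbabilityTheory.bernoulliMeasure true false p

/-- `x → y` is an edge of the graph and it is open in `ω`. -/
def OpenEdge (E : Set (V × V)) (ω : Config E) (x y : V) : Prop :=
  ∃ h : (x, y) ∈ E, ω ⟨(x, y), h⟩ = true

/-- The oriented open cluster `C_+(x)`: the vertices that can be reached from `x` by a (possibly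
empty) path of open edges. -/
def cluster (E : Set (V × V)) (ω : Config E) (x : V) : Set V :=
  {y | Relation.ReflTransGen (OpenEdge E ω) x y}

end General

section Lattice

variable {d : ℕ}

/-- The edges of the translation-invariant oriented graph on `ℤ^d` with set of steps `Dir`. -/
def latticeEdges (Dir : Set (Fin d → ℤ)) : Set ((Fin d → ℤ) × (Fin d → ℤ)) :=
  {e | e.2 - e.1 ∈ Dir}

/-- `D_u(x) = sup_{y ∈ C_+(x)} ⟨y - x, u⟩`, the extension in direction `u` of the open cluster
issued from `x`, as an extended real number. -/
noncomputable def extension (Dir : Set (Fin d → ℤ)) (u : Fin d → ℝ)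
    (ω : Config (latticeEdges Dir)) (x : Fin d → ℤ) : EReal :=
  ⨆ y ∈ cluster (latticeEdges Dir) ω x, ((∑ i, ((y i : ℝ) - (x i : ℝ)) * u i : ℝ) : EReal)

/-- `θ_u(p)`, the probability that the open cluster of the origin is unbounded in direction `u`. -/
noncomputable def theta (Dir : Set (Fin d → ℤ)) (u : Fin d → ℝ) (p : unitInterval) : ℝ :=
  (law (latticeEdges Dir) p).real {ω | extension Dir u ω 0 = ⊤}

/-- `p_c(u) = inf {p > 0 : θ_u(p) > 0}`. -/
noncomputable def pc (Dir : Set (Fin d → ℤ)) (u : Fin d → ℝ) : ℝ :=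
  sInf {p : ℝ | ∃ h : p ∈ unitInterval, 0 < p ∧ 0 < theta Dir u ⟨p, h⟩}

end Lattice

section Classical

/-- The edges of classical oriented percolation on the quadrant `ℤ_+^2`: each vertex `(a, b)` has
an edge to `(a + 1, b)` and an edge to `(a, b + 1)`. -/
def quadrantEdges : Set ((ℕ × ℕ) × (ℕ × ℕ)) :=
  {e | e.2 = (e.1.1 + 1, e.1.2) ∨ e.2 = (e.1.1, e.1.2 + 1)}

/-- The critical parameter of classical oriented bond percolation on `ℤ_+^2`: the infimum of the
`p` for which the open cluster of the origin is infinite with positive probability. -/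
noncomputable def pcOriented : ℝ :=
  sInf {p : ℝ | ∃ h : p ∈ unitInterval, 0 < p ∧
    0 < (law quadrantEdges ⟨p, h⟩).real {ω | (cluster quadrantEdges ω (0, 0)).Infinite}}

end Classical

section Example

/-- `Dir = {(0, -1)} ∪ {(k, 1) : |k| ≤ M}`. -/
def exampleDir (M : ℕ) : Set (Fin 2 → ℤ) :=
  {![0, -1]} ∪ {v | ∃ k : ℤ, |k| ≤ (M : ℤ) ∧ v = ![k, 1]}

/-- The second vector of the canonical basis of `ℝ^2`. -/
def e₂ : Fin 2 → ℝ := ![0, 1]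

end Example

end OrientedPercolation

/-! ### The power series for the square root of 1 - λ -/

namespace CatalanRenewal

open PowerSeries

/-! Downwards, a first moment suffices. Weight each step of a path by s to the power of its gain in
depth. The expected number of open paths with distinct sources reaching depth n is at most s^{-n}
∑_k (p (s + (2M+1)/s))^k. At s = √(2M+1) the ratio is 2p√(2M+1), which is below 1 exactly below the
claimed threshold (`law_unbounded_eq_zero`, `le_pc_neg`).

Upwards, each row is cut into blocks of ⌈M/2⌉ consecutive sites, one for each quadrant vertex of
that level. Every site of a block is joined to every site of the two successor blocks. Exploring
level by level, select one reached site in each reached block: its edges into a given successor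
block contain an open one with probability q = 1 - (1-p)^{⌈M/2⌉}, independently. Percolation on the
quadrant at q therefore forces upward percolation at p (`map_blockConfig`, `pc_le_of_percolates`).

What remains is 1/2 ≤ `pcOriented` ≤ 2/3. The lower half is again a first moment. The upper half is
Liggett's argument: let f(A) be the probability that a stationary renewal set of density 1/2 misses
the finite set A. If f does not increase on average along the levels of percolation at p = 2/3
(`expect_evolved_le`), then, since f is 1/2 at a single site and 1 at the empty set, extinction has
probability at most 1/2.

The renewal measure is encoded by the arcsine-type functional `expect` on ℝ[t]: a missed site acts
as multiplication by t, an unconstrained one as `op 1`, and the difference has rank one because a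
renewal point decouples left from right. One step of percolation replaces the operators by `op
(1/9)`, `op (1/3)` and `op 1`, according to the number of occupied parents. The map `intertwiner`,
written V, carries multiplication by t to `op (1/9)` and satisfies ⟨Va, Vb⟩ = ⟨ta, b⟩, so f is
exactly preserved on a run of adjacent sites. Across a gap, the generating series of the loss
factors (`defect_eq`) into a left and a right series, whose coefficients are nonnegative because
suitable coefficient ratios are monotone (`left_factor_nonneg`, `right_factor_nonneg`). -/

/-- The halved Catalan series `∑ catalan n / (2 * 4 ^ n) λ ^ n`. -/
noncomputable def halfCatalan : ℝ⟦X⟧ := mk fun n => (catalan n : ℝ) / (2 * 4 ^ n)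

/-- The square root of `1 - λ`, as a power series. -/
noncomputable def root : ℝ⟦X⟧ := 1 - X * halfCatalan

/-- This is Catalan's convolution recurrence. It makes the series a root of λ h² - 2h + 1, whence
`root` squares to 1 - λ. -/
lemma two_mul_halfCatalan : 2 * halfCatalan = 1 + X * halfCatalan ^ 2 := by
  have h2 : (2 : ℝ⟦X⟧) = C (2 : ℝ) := (map_ofNat C 2).symm
  ext n
  rw [h2, coeff_C_mul]
  cases n with
  | zero => simp [halfCatalan, catalan_zero]
  | succ n =>
    rw [map_add, coeff_one, if_neg n.succ_ne_zero, zero_add, mul_comm X, coeff_succ_mul_X, sq,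
      coeff_mul]
    simp only [halfCatalan, coeff_mk]
    rw [catalan_succ', Nat.cast_sum, Finset.sum_div, Finset.mul_sum]
    refine Finset.sum_congr rfl fun p hp => ?_
    rw [← Finset.HasAntidiagonal.mem_antidiagonal.mp hp]
    push_cast
    field_simp
    ring

lemma root_sq : root ^ 2 = 1 - X := by
  have h := two_mul_halfCatalan
  unfold root
  linear_combination -(X : ℝ⟦X⟧) * h

lemma halfCatalan_mul : halfCatalan * (1 + root) = 1 := by
  have h := two_mul_halfCatalan
  unfold root
  linear_combination h

lemma coeff_halfCatalan_pos (n : ℕ) : 0 < coeff n halfCatalan := by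
  simp only [halfCatalan, coeff_mk]
  have : 0 < catalan n := by
    have h := succ_mul_catalan_eq_centralBinom n
    have := Nat.centralBinom_pos n
    rcases Nat.eq_zero_or_pos (catalan n) with h0 | h0
    · rw [h0] at h; omega
    · exact h0
  positivity

lemma coeff_halfCatalan_zero : coeff 0 halfCatalan = 1 / 2 := by
  simp [halfCatalan, catalan_zero]

lemma coeff_halfCatalan_succ (n : ℕ) :
    coeff (n + 1) halfCatalan * (2 * (n + 2)) = (2 * n + 1) * coeff n halfCatalan := by
  simp only [halfCatalan, coeff_mk]
  have h1 := succ_mul_catalan_eq_centralBinom n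
  have h2 := succ_mul_catalan_eq_centralBinom (n + 1)
  have h3 := Nat.succ_mul_centralBinom_succ n
  have h : ((n : ℝ) + 2) * catalan (n + 1) = 2 * (2 * n + 1) * catalan n := by
    have e1 : ((n : ℝ) + 1) * catalan n = n.centralBinom := by exact_mod_cast h1
    have e2 : ((n : ℝ) + 1 + 1) * catalan (n + 1) = (n + 1).centralBinom := by exact_mod_cast h2
    have e3 : ((n : ℝ) + 1) * (n + 1).centralBinom = 2 * (2 * n + 1) * n.centralBinom := by
      exact_mod_cast h3
    have hn : (n : ℝ) + 1 ≠ 0 := by positivity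
    apply mul_left_cancel₀ hn
    rw [← e1, ← e2] at e3
    linear_combination e3
  field_simp
  rw [pow_succ]
  linear_combination (4 : ℝ) ^ n * 2 * h

lemma constantCoeff_root : constantCoeff root = 1 := by simp [root]

lemma root_ne_zero : root ≠ 0 := fun h => by
  have := constantCoeff_root
  rw [h] at this
  simp at this

/-! ### The moment functional, the operators and their resolvent series -/

/-- The linear functional on `ℝ[t]` whose moments have generating series `(1 - λ)^{-1/2}`. -/
noncomputable def expect : Polynomial ℝ →ₗ[ℝ] ℝ :=
  Polynomial.lsum fun n => coeff n root⁻¹ • LinearMap.id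

lemma expect_X_pow (n : ℕ) : expect (Polynomial.X ^ n) = coeff n root⁻¹ := by
  simp [expect, ← Polynomial.monomial_one_right_eq_X_pow]

/-- The polynomial `1 - t`. -/
noncomputable def u : Polynomial ℝ := 1 - Polynomial.X

/-- The operator `y ↦ t y + 2 w ⟨u, y⟩ u`. -/
noncomputable def op (w : ℝ) : Module.End ℝ (Polynomial ℝ) :=
  LinearMap.mulLeft ℝ Polynomial.X +
    (2 * w) • (expect ∘ₗ LinearMap.mulLeft ℝ u).smulRight u

lemma op_apply (w : ℝ) (y : Polynomial ℝ) :
    op w y = Polynomial.X * y + (2 * w * expect (u * y)) • u := by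
  simp [op, smul_smul]

/-- Multiplication by t and the rank one projection on u are both symmetric for ⟨a, b⟩ = `expect (a
* b)`. This is what lets operators be moved onto the left test vector. -/
lemma expect_op_symm (w : ℝ) (x y : Polynomial ℝ) :
    expect (x * op w y) = expect (op w x * y) := by
  simp only [op_apply, mul_add, add_mul, map_add, Algebra.mul_smul_comm, Algebra.smul_mul_assoc,
    map_smul, smul_eq_mul]
  rw [mul_comm x u, show x * (Polynomial.X * y) = Polynomial.X * x * y by ring]
  ring

lemma expect_op_pow_symm (w : ℝ) (n : ℕ) (x y : Polynomial ℝ) :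
    expect (x * (op w ^ n) y) = expect ((op w ^ n) x * y) := by
  induction n generalizing x y with
  | zero => simp
  | succ n ih =>
    rw [pow_succ', Module.End.mul_apply, expect_op_symm, ih, ← Module.End.mul_apply,
      ← pow_succ, pow_succ']

/-- The generating series of `⟨x, (op w) ^ n y⟩`. -/
noncomputable def ser (w : ℝ) (x y : Polynomial ℝ) : ℝ⟦X⟧ :=
  mk fun n => expect (x * (op w ^ n) y)

lemma coeff_ser (w : ℝ) (x y : Polynomial ℝ) (n : ℕ) :
    coeff n (ser w x y) = expect (x * (op w ^ n) y) := coeff_mk _ _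

lemma constantCoeff_ser (w : ℝ) (x y : Polynomial ℝ) :
    constantCoeff (ser w x y) = expect (x * y) := by
  rw [← coeff_zero_eq_constantCoeff_apply, coeff_ser, pow_zero, Module.End.one_apply]

lemma ser_comm (w : ℝ) (x y : Polynomial ℝ) : ser w x y = ser w y x := by
  ext n
  rw [coeff_ser, coeff_ser, expect_op_pow_symm, mul_comm]

lemma ser_add_right (w : ℝ) (x y z : Polynomial ℝ) : ser w x (y + z) = ser w x y + ser w x z := by
  ext n
  simp [coeff_ser, mul_add]

lemma ser_smul_right (w c : ℝ) (x y : Polynomial ℝ) : ser w x (c • y) = C c * ser w x y := by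
  ext n
  simp [coeff_ser]

lemma ser_add_left (w : ℝ) (x y z : Polynomial ℝ) : ser w (x + y) z = ser w x z + ser w y z := by
  rw [ser_comm, ser_add_right, ser_comm w z x, ser_comm w z y]

lemma ser_smul_left (w c : ℝ) (x y : Polynomial ℝ) : ser w (c • x) y = C c * ser w x y := by
  rw [ser_comm, ser_smul_right, ser_comm w y x]

lemma X_mul_ser_op (w : ℝ) (x y : Polynomial ℝ) :
    X * ser w x (op w y) = ser w x y - C (expect (x * y)) := by
  ext n
  cases n with
  | zero => simp [constantCoeff_ser]
  | succ n =>
    rw [mul_comm X, coeff_succ_mul_X, map_sub, coeff_C, if_neg n.succ_ne_zero, sub_zero,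
      coeff_ser, coeff_ser, pow_succ, Module.End.mul_apply]

lemma ser_op_left (w : ℝ) (x y : Polynomial ℝ) : ser w (op w x) y = ser w x (op w y) := by
  ext n
  rw [coeff_ser, coeff_ser, ← expect_op_symm, ← Module.End.mul_apply, ← pow_succ', pow_succ,
    Module.End.mul_apply]

lemma op_sub (w w' : ℝ) (y : Polynomial ℝ) :
    op w y = op w' y + (2 * (w - w') * expect (u * y)) • u := by
  rw [op_apply, op_apply, add_assoc, ← add_smul]
  ring_nf

/-- The resolvent identity for the rank one perturbation. -/
lemma ser_resolvent (w w' : ℝ) (x y : Polynomial ℝ) :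
    ser w x y = ser w' x y + C (2 * (w - w')) * (X * (ser w' x u * ser w u y)) := by
  ext n
  induction n generalizing x with
  | zero => simp [constantCoeff_ser]
  | succ n ih =>
    have key : coeff (n + 1) (ser w x y) = coeff n (ser w (op w' x) y) +
        2 * (w - w') * expect (x * u) * coeff n (ser w u y) := by
      rw [coeff_ser, pow_succ', Module.End.mul_apply, op_sub w w', mul_add, map_add,
        expect_op_symm, coeff_ser, coeff_ser, Algebra.mul_smul_comm, map_smul, smul_eq_mul]
      ring
    have shift : ∀ z m, coeff (m + 1) (ser w' x z) = coeff m (ser w' (op w' x) z) := fun z m => by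
      rw [coeff_ser, coeff_ser, pow_succ', Module.End.mul_apply, expect_op_symm]
    rw [key, ih, map_add, map_add, shift, coeff_C_mul, coeff_C_mul, mul_comm X, mul_comm X,
      coeff_succ_mul_X, add_assoc]
    congr 1
    -- What is left is the splitting of a Cauchy product into its index-zero term and a shifted
    -- convolution.
    cases n with
    | zero => simp [constantCoeff_ser]; ring
    | succ n =>
      rw [coeff_succ_mul_X, coeff_mul, coeff_mul, Finset.Nat.sum_antidiagonal_succ]
      simp only [shift]
      rw [coeff_ser w' x u 0, pow_zero, Module.End.one_apply]
      ring

lemma op_zero_apply (y : Polynomial ℝ) : op 0 y = Polynomial.X * y := by simp [op_apply]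

lemma op_zero_pow_apply (n : ℕ) (y : Polynomial ℝ) : (op 0 ^ n) y = Polynomial.X ^ n * y := by
  induction n with
  | zero => simp
  | succ n ih => rw [pow_succ', Module.End.mul_apply, ih, op_zero_apply]; ring

lemma ser_zero_mul (x y : Polynomial ℝ) : ser 0 x y = ser 0 1 (x * y) := by
  ext n
  simp only [coeff_ser, op_zero_pow_apply]
  ring_nf

lemma C_mul_ofNat {a : ℝ} {m n : ℕ} [m.AtLeastTwo] [n.AtLeastTwo]
    (h : (OfNat.ofNat m : ℝ) * a = OfNat.ofNat n) :
    (OfNat.ofNat m : ℝ⟦X⟧) * C a = OfNat.ofNat n := by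
  rw [← map_ofNat (C : ℝ →+* ℝ⟦X⟧) m, ← map_mul, h, map_ofNat]

lemma X_mul_halfCatalan : X * halfCatalan = 1 - root := by unfold root; ring

lemma one_add_root_ne_zero : (1 + root : ℝ⟦X⟧) ≠ 0 := right_ne_zero_of_mul_eq_one halfCatalan_mul

lemma two_add_root_ne_zero : (2 + root : ℝ⟦X⟧) ≠ 0 := fun h => by
  have := congrArg constantCoeff h
  rw [map_add, constantCoeff_root, map_ofNat, map_zero] at this
  norm_num at this

lemma root_mul_ser_one : root * ser 0 1 1 = 1 := by
  have : ser 0 1 1 = root⁻¹ := by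
    ext n
    rw [coeff_ser, op_zero_pow_apply, one_mul, mul_one, expect_X_pow]
  rw [this]
  exact PowerSeries.mul_inv_cancel _ (by rw [constantCoeff_root]; exact one_ne_zero)

lemma expect_one : expect 1 = 1 := by
  have := expect_X_pow 0
  rw [pow_zero] at this
  rw [this]
  simp [constantCoeff_root]

lemma ser_sub_right (w : ℝ) (x y z : Polynomial ℝ) : ser w x (y - z) = ser w x y - ser w x z := by
  rw [eq_sub_iff_add_eq, ← ser_add_right, sub_add_cancel]

lemma X_mul_ser_zero (p : Polynomial ℝ) :
    X * ser 0 1 (Polynomial.X * p) = ser 0 1 p - C (expect p) := by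
  rw [← op_zero_apply, X_mul_ser_op, one_mul]

/-- The moment series is 1/root, so that of 1 - t is 1/root - (1/root - 1)/λ, which is (1 - root)/λ
because root² = 1 - λ. -/
lemma ser_one_u : ser 0 1 u = halfCatalan := by
  apply mul_left_cancel₀ (X_ne_zero (R := ℝ))
  have h := X_mul_ser_zero 1
  rw [expect_one, map_one, mul_one] at h
  have h1 : ser 0 1 u = ser 0 1 1 - ser 0 1 Polynomial.X := by rw [u, ser_sub_right]
  have h2 := root_mul_ser_one
  have h3 := root_sq
  rw [h1, X_mul_halfCatalan]
  apply mul_left_cancel₀ root_ne_zero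
  linear_combination -root * h + (X - 1) * h2 + h3

lemma expect_X_pow_mul_u (n : ℕ) : expect (Polynomial.X ^ n * u) = coeff n halfCatalan := by
  rw [← ser_one_u, coeff_ser, op_zero_pow_apply, one_mul]

lemma expect_u : expect u = 1 / 2 := by
  rw [← coeff_halfCatalan_zero, ← expect_X_pow_mul_u, pow_zero, one_mul]

lemma coeff_halfCatalan_one : coeff 1 halfCatalan = 1 / 8 := by
  have := coeff_halfCatalan_succ 0
  rw [coeff_halfCatalan_zero] at this
  norm_num at this
  linarith

lemma coeff_halfCatalan_two : coeff 2 halfCatalan = 1 / 16 := by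
  have := coeff_halfCatalan_succ 1
  rw [coeff_halfCatalan_one] at this
  norm_num at this
  linarith

lemma expect_X_pow_mul_u_sq (n : ℕ) : expect (Polynomial.X ^ n * (u * u)) =
    coeff n halfCatalan - coeff (n + 1) halfCatalan := by
  rw [← expect_X_pow_mul_u, ← expect_X_pow_mul_u, ← map_sub]
  congr 1
  simp only [u]
  ring

lemma expect_u_sq : expect (u * u) = 3 / 8 := by
  have := expect_X_pow_mul_u_sq 0
  rw [pow_zero, one_mul, coeff_halfCatalan_zero, zero_add, coeff_halfCatalan_one] at this
  rw [this]; norm_num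

lemma ser_u_u : 2 * (X * ser 0 u u) = 1 - 2 * root ^ 2 * halfCatalan := by
  have h1 : ser 0 u u = halfCatalan - ser 0 1 (Polynomial.X * u) := by
    rw [ser_zero_mul, ← ser_one_u, ← ser_sub_right]
    congr 1
    simp only [u]
    ring
  have h2 := X_mul_ser_zero u
  rw [ser_one_u, expect_u] at h2
  have h3 : (2 : ℝ⟦X⟧) * C (1 / 2 : ℝ) = 1 := by
    rw [← map_ofNat (C : ℝ →+* ℝ⟦X⟧) 2, ← map_mul]; norm_num
  rw [h1, root_sq]
  linear_combination -2 * h2 + h3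

lemma one_add_root_mul_ser_u_u :
    2 * (1 + root) * (X * ser 0 u u) = 1 + root - 2 * root ^ 2 := by
  linear_combination (1 + root) * ser_u_u - 2 * root ^ 2 * halfCatalan_mul

lemma nine_mul_C : (9 : ℝ⟦X⟧) * C (2 * (1 / 9 - 0) : ℝ) = 2 := C_mul_ofNat (by norm_num)

lemma ser_ninth_resolvent (x y : Polynomial ℝ) :
    9 * ser (1 / 9) x y = 9 * ser 0 x y + 2 * (X * (ser 0 x u * ser (1 / 9) u y)) := by
  rw [ser_resolvent (1 / 9) 0 x y]
  linear_combination (X * (ser 0 x u * ser (1 / 9) u y)) * nine_mul_C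

/-- Solving the rank one resolvent equation produces the denominator 9(1 + root) - (1 - root)(1 + 2
root) = 2(2 + root)². This perfect square is special to the weight 1/9. -/
lemma X_mul_ser_ninth_u_u :
    4 * (2 + root) ^ 2 * (X * ser (1 / 9) u u) = 9 * ((1 - root) * (1 + 2 * root)) := by
  have h := ser_ninth_resolvent u u
  have ht := one_add_root_mul_ser_u_u
  linear_combination (2 * (1 + root) * X) * h + (9 + 2 * X * ser (1 / 9) u u) * ht

lemma ser_ninth_u (x : Polynomial ℝ) :
    2 * (2 + root) ^ 2 * ser (1 / 9) x u = 9 * (1 + root) * ser 0 x u := by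
  have h := ser_ninth_resolvent x u
  have ht := X_mul_ser_ninth_u_u
  have h18 : (18 : ℝ⟦X⟧) ≠ 0 := by
    rw [← map_ofNat (C : ℝ →+* ℝ⟦X⟧) 18]; simp
  apply mul_left_cancel₀ h18
  linear_combination 4 * (2 + root) ^ 2 * h + 2 * ser 0 x u * ht

/-! ### Runs of adjacent marks and the intertwiner -/

/-- The image of `1` under `op (1 / 3)`. -/
noncomputable def φ : Polynomial ℝ := 1 - (2 / 3 : ℝ) • u

lemma op_third_one : op (1 / 3) 1 = φ := by
  rw [op_apply, φ, mul_one, mul_one, expect_u, show (Polynomial.X : Polynomial ℝ) = 1 - u by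
    simp [u]]
  module

/-- The normalisation 2⟨u, 1⟩ = 1: unmarked sites impose no constraint, so they may be appended
freely. -/
lemma op_one_one : op 1 1 = 1 := by
  rw [op_apply, mul_one, mul_one, mul_one, expect_u]
  simp [u]

lemma three_mul_C : (3 : ℝ⟦X⟧) * C (2 / 3 : ℝ) = 2 := C_mul_ofNat (by norm_num)

lemma ser_zero_φ_u : 3 * (1 + root) * (X * ser 0 φ u) = (2 + root) * (1 - root) := by
  have h1 : ser 0 φ u = halfCatalan - C (2 / 3 : ℝ) * ser 0 u u := by
    rw [ser_comm, φ, ser_sub_right, ser_smul_right, ser_comm, ser_one_u]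
  rw [h1]
  linear_combination 3 * (1 + root) * X_mul_halfCatalan - (1 + root) * X * ser 0 u u * three_mul_C
    - one_add_root_mul_ser_u_u

lemma one_sub_root_ne_zero : (1 - root : ℝ⟦X⟧) ≠ 0 := by
  rw [← X_mul_halfCatalan]
  exact mul_ne_zero X_ne_zero (left_ne_zero_of_mul_eq_one halfCatalan_mul)

/-- The series `∑ ⟨u, (op (1/9)) ^ n φ⟩ λ ^ n`. -/
noncomputable def zeta : ℝ⟦X⟧ := ser (1 / 9) u φ

lemma zeta_mul : 2 * (2 + root) * (1 + root) * zeta = 3 := by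
  have h := ser_ninth_u φ
  rw [ser_comm] at h
  have h1 := ser_zero_φ_u
  have h2 := root_sq
  apply mul_left_cancel₀ (mul_ne_zero (mul_ne_zero one_sub_root_ne_zero two_add_root_ne_zero)
    one_add_root_ne_zero)
  unfold zeta
  linear_combination (X * (1 + root)) * h + 3 * (1 + root) * h1
    - 2 * (2 + root) ^ 2 * ser (1 / 9) u φ * (1 + root) * h2

lemma ser_φ_φ : root * (X * ser (1 / 9) φ φ) = 1 - root := by
  have h := ser_ninth_resolvent φ φ
  have hz := zeta_mul
  have h1 := ser_zero_φ_u
  have h2 := one_add_root_mul_ser_u_u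
  have h3 : ser 0 φ φ = ser 0 1 1 - C (2 / 3 : ℝ) * (halfCatalan + halfCatalan) +
      C (2 / 3 : ℝ) * (C (2 / 3 : ℝ) * ser 0 u u) := by
    have : φ * φ = 1 - (2 / 3 : ℝ) • (u + u) + (2 / 3 : ℝ) • ((2 / 3 : ℝ) • (u * u)) := by
      rw [φ]
      simp only [sub_mul, mul_sub, one_mul, mul_one, Algebra.smul_mul_assoc,
        Algebra.mul_smul_comm]
      module
    rw [ser_zero_mul, this, ser_add_right, ser_sub_right, ser_smul_right, ser_smul_right,
      ser_smul_right, ser_add_right, ser_one_u, ← ser_zero_mul]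
  have h4 := root_mul_ser_one
  have h5 := three_mul_C
  have h6 := X_mul_halfCatalan
  have h7 : 9 * ser 0 φ φ = 9 * ser 0 1 1 - 12 * halfCatalan + 4 * ser 0 u u := by
    rw [h3]
    linear_combination (-6 * halfCatalan + (2 + 3 * C (2 / 3 : ℝ)) * ser 0 u u) * h5
  have h8 := root_sq
  change _ = 9 * ser 0 φ φ + 2 * (X * (ser 0 φ u * zeta)) at h
  have h9 : (9 : ℝ⟦X⟧) ≠ 0 := by
    rw [← map_ofNat (C : ℝ →+* ℝ⟦X⟧) 9]; simp
  have h10 : (1 + root) * (3 * (1 + root)) ≠ (0 : ℝ⟦X⟧) := by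
    refine mul_ne_zero one_add_root_ne_zero (mul_ne_zero ?_ one_add_root_ne_zero)
    rw [← map_ofNat (C : ℝ →+* ℝ⟦X⟧) 3]; simp
  apply mul_left_cancel₀ (mul_ne_zero h9 (mul_ne_zero two_add_root_ne_zero h10))
  linear_combination (root * X * (2 + root) * 3 * (1 + root) ^ 2) * (h + h7)
    + 27 * X * (2 + root) * (1 + root) ^ 2 * h4 - 36 * root * (2 + root) * (1 + root) ^ 2 * h6
    + 6 * root * (2 + root) * (1 + root) * h2 + 3 * root * X * (1 + root) * (X * ser 0 φ u) * hz
    + 3 * root * X * h1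
    + (27 * (2 + root) * (1 + root) ^ 2 + 3 * root * (2 + root) * (1 - root)) * h8

/-- A run of n + 1 marks evolves into n sites with two marked parents between two sites with one.
The identity says that the avoidance probability of such a run is preserved exactly; it is the
equality case behind the value p = 2/3. -/
lemma expect_φ_op_pow_φ (n : ℕ) :
    expect (φ * (op (1 / 9) ^ n) φ) = expect (Polynomial.X ^ (n + 1)) := by
  have h := ser_φ_φ
  have h1 := root_mul_ser_one
  have h2 : X * ser (1 / 9) φ φ = ser 0 1 1 - 1 := by
    apply mul_left_cancel₀ root_ne_zero
    linear_combination h - h1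
  have h3 := congrArg (coeff (n + 1)) h2
  rw [mul_comm X, coeff_succ_mul_X, coeff_ser, map_sub, coeff_one, if_neg n.succ_ne_zero, sub_zero,
    coeff_ser, op_zero_pow_apply, one_mul, mul_one] at h3
  exact h3

/-- The operator intertwining `op (1/9)` with multiplication by `t`, and sending `1` to `φ`. -/
noncomputable def intertwiner : Polynomial ℝ →ₗ[ℝ] Polynomial ℝ :=
  LinearMap.applyₗ φ ∘ₗ (Polynomial.aeval (op (1 / 9))).toLinearMap

lemma intertwiner_apply (y : Polynomial ℝ) :
    intertwiner y = (Polynomial.aeval (op (1 / 9)) y) φ := rfl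

lemma intertwiner_X_mul (y : Polynomial ℝ) :
    intertwiner (Polynomial.X * y) = op (1 / 9) (intertwiner y) := by
  simp [intertwiner_apply]

lemma intertwiner_X_pow_mul (n : ℕ) (y : Polynomial ℝ) :
    intertwiner (Polynomial.X ^ n * y) = (op (1 / 9) ^ n) (intertwiner y) := by
  simp [intertwiner_apply]

lemma intertwiner_one : intertwiner 1 = φ := by simp [intertwiner_apply]

/-- By bilinearity and the intertwining relation it suffices to compare moments of φ under `op
(1/9)`, which `expect_φ_op_pow_φ` computes. -/
lemma expect_intertwiner_mul (a b : Polynomial ℝ) :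
    expect (intertwiner a * intertwiner b) = expect (Polynomial.X * a * b) := by
  induction a using Polynomial.induction_on' with
  | add p q hp hq => rw [map_add, add_mul, map_add, hp, hq, mul_add, add_mul, map_add]
  | monomial m c =>
    induction b using Polynomial.induction_on' with
    | add p q hp hq => rw [map_add, mul_add, map_add, hp, hq, mul_add, map_add]
    | monomial n d =>
      have e : ∀ (k : ℕ) (r : ℝ), Polynomial.monomial k r = r • (Polynomial.X ^ k * 1) := by
        intro k r
        rw [mul_one, Polynomial.smul_X_eq_monomial]
      rw [e, e, map_smul, map_smul, intertwiner_X_pow_mul, intertwiner_X_pow_mul, intertwiner_one,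
        Algebra.smul_mul_assoc, Algebra.mul_smul_comm, Algebra.mul_smul_comm,
        Algebra.mul_smul_comm, Algebra.smul_mul_assoc, map_smul, map_smul, map_smul, map_smul,
        ← expect_op_pow_symm, ← Module.End.mul_apply, ← pow_add, expect_φ_op_pow_φ]
      ring_nf

lemma op_ninth_u : op (1 / 9) u = Polynomial.X * u + (1 / 12 : ℝ) • u := by
  rw [op_apply, expect_u_sq]; norm_num

/-- Expressing this image through u and its `op (1/9)` image lets pairings with it be read off from
series that pair with u alone. -/
lemma intertwiner_u : intertwiner u = (2 / 3 : ℝ) • op (1 / 9) u + (2 / 9 : ℝ) • u := by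
  have h1 : intertwiner u = φ - op (1 / 9) φ := by
    have : u = 1 - Polynomial.X * 1 := by simp [u]
    rw [this, map_sub, intertwiner_X_mul, intertwiner_one]
  have h2 : expect (u * φ) = 1 / 4 := by
    rw [φ, mul_sub, mul_one, Algebra.mul_smul_comm, map_sub, map_smul, expect_u, expect_u_sq]
    norm_num
  rw [h1, op_ninth_u, op_apply, h2, φ, show (Polynomial.X : Polynomial ℝ) = 1 - u by simp [u]]
  simp only [sub_mul, mul_sub, one_mul, mul_one, Algebra.mul_smul_comm]
  module

lemma intertwiner_op (y : Polynomial ℝ) : intertwiner (op 1 y) =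
    op (1 / 9) (intertwiner y) + (2 * expect (u * y)) • intertwiner u := by
  rw [op_apply, map_add, intertwiner_X_mul, map_smul, mul_one]

/-- The generating series of `⟨u, (op (1/9)) ^ n (intertwiner y)⟩`. -/
noncomputable def profile (y : Polynomial ℝ) : ℝ⟦X⟧ := ser (1 / 9) u (intertwiner y)

lemma expect_u_mul_X_pow (n : ℕ) (y : Polynomial ℝ) :
    expect (u * (Polynomial.X ^ (n + 1) * y)) =
      2 / 3 * coeff (n + 1) (profile y) + 2 / 9 * coeff n (profile y) := by
  have h := expect_intertwiner_mul u (Polynomial.X ^ n * y)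
  rw [show Polynomial.X * u * (Polynomial.X ^ n * y) = u * (Polynomial.X ^ (n + 1) * y) by ring]
    at h
  rw [← h, intertwiner_u, intertwiner_X_pow_mul, add_mul, map_add, Algebra.smul_mul_assoc,
    Algebra.smul_mul_assoc, map_smul, map_smul, ← expect_op_symm, ← Module.End.mul_apply,
    ← pow_succ', profile, coeff_ser, coeff_ser, smul_eq_mul, smul_eq_mul]

lemma ser_u_X_mul (y : Polynomial ℝ) : 9 * (X * ser 0 u (Polynomial.X * y)) =
    6 * (profile y - C (coeff 0 (profile y))) + 2 * (X * profile y) := by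
  ext n
  rw [← map_ofNat (C : ℝ →+* ℝ⟦X⟧) 9, ← map_ofNat (C : ℝ →+* ℝ⟦X⟧) 6,
    ← map_ofNat (C : ℝ →+* ℝ⟦X⟧) 2, map_add, coeff_C_mul, coeff_C_mul, coeff_C_mul]
  cases n with
  | zero => simp
  | succ n =>
    rw [mul_comm X, mul_comm X, coeff_succ_mul_X, coeff_succ_mul_X, map_sub, coeff_C,
      if_neg n.succ_ne_zero, sub_zero, coeff_ser, op_zero_pow_apply, ← mul_assoc (_ ^ n),
      ← pow_succ, expect_u_mul_X_pow]
    ring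

/-- The generating series of `⟨x, intertwiner ((op 1) ^ n y)⟩`. -/
noncomputable def mixedSer (x y : Polynomial ℝ) : ℝ⟦X⟧ :=
  mk fun n => expect (x * intertwiner ((op 1 ^ n) y))

/-- By `intertwiner_op`, moving V past `op 1` gives `op (1/9)` plus a rank one term; unrolling the
powers gives a convolution, as in `ser_resolvent`. -/
lemma mixedSer_eq (x y : Polynomial ℝ) : mixedSer x y = ser (1 / 9) x (intertwiner y) +
    2 * (X * (ser (1 / 9) x (intertwiner u) * ser 1 u y)) := by
  rw [← map_ofNat (C : ℝ →+* ℝ⟦X⟧) 2]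
  ext n
  induction n generalizing x with
  | zero => simp [constantCoeff_ser, mixedSer]
  | succ n ih =>
    have key : coeff (n + 1) (mixedSer x y) = coeff n (mixedSer (op (1 / 9) x) y) +
        2 * expect (x * intertwiner u) * coeff n (ser 1 u y) := by
      rw [mixedSer, coeff_mk, pow_succ', Module.End.mul_apply, intertwiner_op, mul_add, map_add,
        expect_op_symm, mixedSer, coeff_mk, coeff_ser, Algebra.mul_smul_comm, map_smul,
        smul_eq_mul]
      ring
    have shift : ∀ z m, coeff (m + 1) (ser (1 / 9) x z) = coeff m (ser (1 / 9) (op (1 / 9) x) z) :=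
      fun z m => by
        rw [coeff_ser, coeff_ser, pow_succ', Module.End.mul_apply, expect_op_symm]
    rw [key, ih, map_add, map_add, shift, coeff_C_mul, coeff_C_mul, mul_comm X, mul_comm X,
      coeff_succ_mul_X, add_assoc]
    congr 1
    cases n with
    | zero => simp [constantCoeff_ser]; ring
    | succ n =>
      rw [coeff_succ_mul_X, coeff_mul, coeff_mul, Finset.Nat.sum_antidiagonal_succ]
      simp only [shift]
      rw [coeff_ser _ x (intertwiner u) 0, pow_zero, Module.End.one_apply]
      ring

/-! ### The loss across a gap between marks -/

/-- The generating series of the defect across a gap. -/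
noncomputable def defect (x y : Polynomial ℝ) : ℝ⟦X⟧ :=
  mk fun n => expect (x * intertwiner ((op 1 ^ (n + 1)) (Polynomial.X * y))) -
    expect (x * op (1 / 3) ((op 1 ^ n) (op (1 / 3) (intertwiner y))))

lemma op_third (y : Polynomial ℝ) :
    op (1 / 3) y = op (1 / 9) y + (4 / 9 : ℝ) • (expect (u * y) • u) := by
  rw [op_sub (1 / 3) (1 / 9), smul_smul]; norm_num

lemma ser_one_resolvent_ninth (x y : Polynomial ℝ) :
    9 * ser 1 x y = 9 * ser (1 / 9) x y + 16 * (X * (ser (1 / 9) x u * ser 1 u y)) := by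
  have hc : (9 : ℝ⟦X⟧) * C (2 * (1 - 1 / 9) : ℝ) = 16 := C_mul_ofNat (by norm_num)
  rw [ser_resolvent 1 (1 / 9) x y]
  linear_combination (X * (ser (1 / 9) x u * ser 1 u y)) * hc

lemma ser_one_resolvent_zero (x y : Polynomial ℝ) :
    ser 1 x y = ser 0 x y + 2 * (X * (ser 0 x u * ser 1 u y)) := by
  have hc : C (2 * (1 - 0) : ℝ) = (2 : ℝ⟦X⟧) := by
    rw [← map_ofNat (C : ℝ →+* ℝ⟦X⟧) 2]; norm_num
  rw [ser_resolvent 1 0 x y, hc]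

/-- Across a gap the defect factors. -/
lemma defect_eq (x y : Polynomial ℝ) :
    81 * (X ^ 2 * defect x y) =
      4 * ((2 + root) * ser (1 / 9) x u - 3 * C (expect (x * u))) *
        ((1 + root) * ((2 + root) * profile y - 3 * C (coeff 0 (profile y)))) := by
  set a := ser (1 / 9) x u with ha
  set Z := profile y with hZ
  set A := C (expect (x * u)) with hA
  set B := C (coeff 0 Z) with hB
  set ν := ser (1 / 9) u u with hν
  set v := intertwiner y with hv
  set A1 := ser (1 / 9) x (op (1 / 9) u) with hA1
  set Z1 := ser (1 / 9) u (op (1 / 9) v) with hZ1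
  set G := ser (1 / 9) x (op (1 / 9) v) with hG
  set G2 := ser (1 / 9) x (op (1 / 9) (op (1 / 9) v)) with hG2
  set J := ser 1 u (Polynomial.X * y) with hJ
  set J0 := ser 0 u (Polynomial.X * y) with hJ0
  set L := ser 1 u (op (1 / 3) v) with hL
  set l := ser (1 / 9) u (op (1 / 3) v) with hl
  set k := ser (1 / 9) (op (1 / 3) x) u with hk
  set kk := ser (1 / 9) (op (1 / 3) x) (op (1 / 3) v) with hkk
  set K := ser 1 (op (1 / 3) x) (op (1 / 3) v) with hK
  have hB' : B = C (expect (u * v)) := by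
    rw [hB, hZ, profile, coeff_ser, pow_zero, Module.End.one_apply]
  have eA1 : X * A1 = a - A := X_mul_ser_op _ _ _
  have eZ1 : X * Z1 = Z - B := by rw [hB']; exact X_mul_ser_op _ _ _
  have eG2 : X * G2 = G - C (expect (x * op (1 / 9) v)) := X_mul_ser_op _ _ _
  have h9 : (9 : ℝ⟦X⟧) * C (4 / 9 : ℝ) = 4 := C_mul_ofNat (by norm_num)
  have h3 := three_mul_C
  have h92 : (9 : ℝ⟦X⟧) * C (2 / 9 : ℝ) = 2 := C_mul_ofNat (by norm_num)
  have hq := root_sq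
  have hU := halfCatalan_mul
  -- the unevolved side
  have eBU : 9 * ser (1 / 9) x (intertwiner u) = 6 * A1 + 2 * a := by
    rw [intertwiner_u, ser_add_right, ser_smul_right, ser_smul_right]
    linear_combination 3 * A1 * h3 + a * h92
  have eM : X * (mk fun n => expect (x * intertwiner ((op 1 ^ (n + 1)) (Polynomial.X * y)))) =
      mixedSer x (Polynomial.X * y) - C (expect (x * op (1 / 9) v)) := by
    ext n
    cases n with
    | zero => simp [mixedSer, intertwiner_X_mul, hv]
    | succ n => rw [mul_comm X, coeff_succ_mul_X, map_sub, coeff_C, if_neg n.succ_ne_zero, sub_zero,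
        mixedSer, coeff_mk, coeff_mk]
  -- For weight 1 the resolvent denominator 1 - 2λ⟨u, u⟩-series equals 2 root²/(1 + root).
  have eJ : J * (2 * root ^ 2) = (1 + root) * J0 := by
    have h1 := ser_one_resolvent_zero u (Polynomial.X * y)
    rw [← hJ, ← hJ0] at h1
    linear_combination (1 + root) * h1 + J * one_add_root_mul_ser_u_u
  have eJ0 : 9 * (X * J0) = 6 * (Z - B) + 2 * (X * Z) := ser_u_X_mul y
  have eM2 : (mk fun n => expect (x * intertwiner ((op 1 ^ (n + 1)) (Polynomial.X * y)))) =
      G2 + 2 * (ser (1 / 9) x (intertwiner u) * J) := by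
    apply mul_left_cancel₀ (X_ne_zero (R := ℝ))
    rw [eM, mixedSer_eq, intertwiner_X_mul, ← hv, ← hG, ← hJ, mul_add, eG2]
    ring
  -- the evolved side
  have eK : (mk fun n => expect (x * op (1 / 3) ((op 1 ^ n) (op (1 / 3) v)))) = K := by
    ext n
    rw [coeff_mk, hK, coeff_ser, expect_op_symm]
  have eL : 9 * L = 9 * l + 16 * (X * (ν * L)) := ser_one_resolvent_ninth _ _
  have eν : 4 * (2 + root) ^ 2 * (X * ν) = 9 * ((1 - root) * (1 + 2 * root)) :=
    X_mul_ser_ninth_u_u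
  have eL2 : 9 * root ^ 2 * L = (2 + root) ^ 2 * l := by
    have h36 : (36 : ℝ⟦X⟧) ≠ 0 := by
      rw [← map_ofNat (C : ℝ →+* ℝ⟦X⟧) 36]; simp
    apply mul_left_cancel₀ h36
    linear_combination 4 * (2 + root) ^ 2 * eL + 16 * L * eν
  have el : 9 * l = 9 * Z1 + 4 * (B * ν) := by
    rw [hl, op_third, ser_add_right, ser_smul_right, ser_smul_right, ← hB']
    linear_combination (B * ν) * h9
  have ek : 9 * k = 9 * A1 + 4 * (A * ν) := by
    rw [hk, op_third, ser_add_left, ser_smul_left, ser_smul_left, ser_op_left, mul_comm u x]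
    linear_combination (A * ν) * h9
  have ekk : 81 * kk = 81 * G2 + 36 * (A * Z1) + 36 * (B * A1) + 16 * (A * B * ν) := by
    have e1 : kk = ser (1 / 9) (op (1 / 3) x) (op (1 / 9) v) + C (4 / 9 : ℝ) * (B * k) := by
      rw [hkk, op_third v, ser_add_right, ser_smul_right, ser_smul_right, ← hB']
    have e2 : ser (1 / 9) (op (1 / 3) x) (op (1 / 9) v) = G2 + C (4 / 9 : ℝ) * (A * Z1) := by
      rw [op_third x, ser_add_left, ser_smul_left, ser_smul_left, ser_op_left, mul_comm u x]
    rw [e1, e2]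
    linear_combination (9 * A * Z1 + 9 * B * k) * h9 + 4 * B * ek
  have eKK : 9 * K = 9 * kk + 16 * (X * (k * L)) := ser_one_resolvent_ninth _ _
  have eD : defect x y = G2 + 2 * (ser (1 / 9) x (intertwiner u) * J) - K := by
    rw [← eM2, ← eK]
    rfl
  have hmain : (2 + root) ^ 2 * root ^ 2 ≠ (0 : ℝ⟦X⟧) :=
    mul_ne_zero (pow_ne_zero _ two_add_root_ne_zero) (pow_ne_zero _ root_ne_zero)
  have e1 : 81 * (root ^ 2 * defect x y) = 9 * (1 + root) * (6 * A1 + 2 * a) * J0 -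
      root ^ 2 * (36 * (A * Z1) + 36 * (B * A1) + 16 * (A * B * ν)) -
      16 * (X * (k * ((2 + root) ^ 2 * l))) := by
    linear_combination 81 * root ^ 2 * eD + 18 * root ^ 2 * J * eBU + 9 * (6 * A1 + 2 * a) * eJ
      - 9 * root ^ 2 * eKK - root ^ 2 * ekk - 16 * X * k * eL2
  have h9' : (9 : ℝ⟦X⟧) ≠ 0 := by
    rw [← map_ofNat (C : ℝ →+* ℝ⟦X⟧) 9]; simp
  have ekX : (2 + root) ^ 2 * (X * k) =
      (2 + root) ^ 2 * (a - A) + A * ((1 - root) * (1 + 2 * root)) := by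
    apply mul_left_cancel₀ h9'
    linear_combination (2 + root) ^ 2 * X * ek + 9 * (2 + root) ^ 2 * eA1 + A * eν
  have elX : (2 + root) ^ 2 * (X * l) =
      (2 + root) ^ 2 * (Z - B) + B * ((1 - root) * (1 + 2 * root)) := by
    apply mul_left_cancel₀ h9'
    linear_combination (2 + root) ^ 2 * X * el + 9 * (2 + root) ^ 2 * eZ1 + B * eν
  apply mul_left_cancel₀ hmain
  have e2 : (2 + root) ^ 2 * root ^ 2 * (81 * (X ^ 2 * defect x y)) =
      (2 + root) ^ 2 * ((1 + root) * (6 * (a - A) + 2 * (X * a)) * (6 * (Z - B) + 2 * (X * Z)) -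
        root ^ 2 * X * (36 * (A * (Z - B)) + 36 * (B * (a - A)))) -
      36 * root ^ 2 * X * (A * B * ((1 - root) * (1 + 2 * root))) -
      16 * X * ((2 + root) ^ 2 * (a - A) + A * ((1 - root) * (1 + 2 * root))) *
        ((2 + root) ^ 2 * (Z - B) + B * ((1 - root) * (1 + 2 * root))) := by
    rw [← ekX, ← elX]
    linear_combination (2 + root) ^ 2 * X ^ 2 * e1
      + (2 + root) ^ 2 * (54 * (1 + root) * X * J0 - 36 * root ^ 2 * X * B) * eA1
      - 36 * (2 + root) ^ 2 * root ^ 2 * X * A * eZ1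
      + (2 + root) ^ 2 * (1 + root) * (6 * (a - A) + 2 * (X * a)) * eJ0
      - 4 * root ^ 2 * X * A * B * eν
  -- Everything is now expressed through a, A, Z, B and root; eliminating λ = 1 - root² leaves a
  -- polynomial identity.
  rw [e2, show (X : ℝ⟦X⟧) = 1 - root ^ 2 by rw [hq]; ring]
  ring

/-! ### Sequences with monotone ratios -/

/-- The sequence `α` is nonnegative, with nondecreasing quotients `α j / c j`. -/
def RatioMono (c α : ℕ → ℝ) : Prop := 0 ≤ α 0 ∧ ∀ j, α j * c (j + 1) ≤ α (j + 1) * c j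

namespace RatioMono

variable {c α : ℕ → ℝ}

lemma nonneg (h : RatioMono c α) (hc : ∀ j, 0 < c j) (j : ℕ) : 0 ≤ α j := by
  induction j with
  | zero => exact h.1
  | succ j ih =>
    exact nonneg_of_mul_nonneg_left ((mul_nonneg ih (hc (j + 1)).le).trans (h.2 j)) (hc j)

lemma le_of_le (h : RatioMono c α) (hc : ∀ j, 0 < c j) {j k : ℕ} (hjk : j ≤ k) :
    α j * c k ≤ α k * c j := by
  induction k, hjk using Nat.le_induction with
  | base => exact le_rfl
  | succ k _ ih =>
    refine le_of_mul_le_mul_right ?_ (hc k)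
    calc α j * c (k + 1) * c k = α j * c k * c (k + 1) := by ring
      _ ≤ α k * c j * c (k + 1) := mul_le_mul_of_nonneg_right ih (hc _).le
      _ = α k * c (k + 1) * c j := by ring
      _ ≤ α (k + 1) * c k * c j := mul_le_mul_of_nonneg_right (h.2 k) (hc _).le
      _ = α (k + 1) * c j * c k := by ring

/-- With β = α - κ c, the new sequence is β_{j+1} + κ c_j. Divided by c_j this is
(β_{j+1}/c_{j+1})(c_{j+1}/c_j) + κ, a product of nonnegative nondecreasing factors plus a constant,
by log-convexity of c. -/
lemma step (h : RatioMono c α) (hc : ∀ j, 0 < c j)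
    (hlc : ∀ j, c (j + 1) * c (j + 1) ≤ c j * c (j + 2)) {κ : ℝ} (h0 : 0 ≤ κ)
    (hκ : κ * c 0 ≤ α 0) : RatioMono c (fun j => α (j + 1) + κ * (c j - c (j + 1))) := by
  have hβ : RatioMono c (fun j => α j - κ * c j) :=
    ⟨by simpa using hκ, fun j => by have := h.2 j; nlinarith⟩
  have hn := hβ.nonneg hc
  refine ⟨?_, fun j => ?_⟩
  · have := hn 1
    have := mul_nonneg h0 (hc 0).le
    simp only [zero_add] at *
    linarith
  · refine le_of_mul_le_mul_right ?_ (hc (j + 1))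
    have h1 := mul_le_mul_of_nonneg_left (hlc j) (hn (j + 1))
    have h2 := mul_le_mul_of_nonneg_right (hβ.2 (j + 1)) (hc j).le
    simp only at h1 h2
    nlinarith

end RatioMono

/-- Compare c_k (gα)_k with α_k (gc)_k term by term: for j ≤ k one has α_j c_k ≤ α_k c_j, and the
nonpositive coefficients of g reverse this in the required direction. The constant term of g, of any
sign, contributes equally to both. -/
lemma coeff_mul_nonneg_of_ratioMono {g c α : ℝ⟦X⟧} (hg : ∀ i, coeff (i + 1) g ≤ 0)
    (hc : ∀ j, 0 < coeff j c) (h : RatioMono (fun j => coeff j c) (fun j => coeff j α)) {k : ℕ}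
    (hk : 0 ≤ coeff k (g * c)) : 0 ≤ coeff k (g * α) := by
  refine nonneg_of_mul_nonneg_left (b := coeff k c) ?_ (hc k)
  refine (mul_nonneg (h.nonneg hc k) hk).trans ?_
  rw [coeff_mul, coeff_mul, Finset.mul_sum, Finset.sum_mul]
  refine Finset.sum_le_sum fun p hp => ?_
  have hp' := Finset.HasAntidiagonal.mem_antidiagonal.mp hp
  obtain ⟨i, j⟩ := p
  cases i with
  | zero =>
    obtain rfl : j = k := by simpa using hp'
    exact le_of_eq (by ring)
  | succ i =>
    have h1 := h.le_of_le hc (show j ≤ k by simp only at hp'; omega)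
    have := mul_le_mul_of_nonpos_left h1 (hg i)
    simp only at this ⊢
    linarith

/-- Consecutive ratios are (2n+1)/(2n+4), which increase with n. -/
lemma coeff_halfCatalan_logConvex (n : ℕ) :
    coeff (n + 1) halfCatalan * coeff (n + 1) halfCatalan ≤
      coeff n halfCatalan * coeff (n + 2) halfCatalan := by
  have h1 := coeff_halfCatalan_succ n
  have h2 := coeff_halfCatalan_succ (n + 1)
  have p0 := coeff_halfCatalan_pos n
  have p1 := coeff_halfCatalan_pos (n + 1)
  push_cast at h2
  have hn : (0 : ℝ) < 2 * (n + 3) * (2 * n + 1) := by positivity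
  refine le_of_mul_le_mul_right ?_ hn
  have e : coeff n halfCatalan * coeff (n + 2) halfCatalan * (2 * (n + 3) * (2 * n + 1)) =
      coeff (n + 1) halfCatalan * coeff (n + 1) halfCatalan * ((2 * n + 3) * (2 * (n + 2))) := by
    linear_combination coeff n halfCatalan * (2 * n + 1) * h2 -
      coeff (n + 1) halfCatalan * (2 * n + 3) * h1
  rw [e]
  refine mul_le_mul_of_nonneg_left ?_ (mul_nonneg p1.le p1.le)
  nlinarith

/-- `⟨x, t ^ j u⟩` grows at least as fast as `⟨1, t ^ j u⟩`. -/
def LeftGood (x : Polynomial ℝ) : Prop :=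
  RatioMono (fun j => coeff j halfCatalan) (fun j => coeff j (ser 0 x u))

lemma leftGood_one : LeftGood 1 := by
  unfold LeftGood
  rw [ser_one_u]
  exact ⟨(coeff_halfCatalan_pos 0).le, fun j => le_of_eq (mul_comm _ _)⟩

/-- Applying the operator shifts the coefficients and adds κ(c_j - c_{j+1}) with κ = 2w⟨u, x⟩. The
bound κ c_0 ≤ α_0 required by `RatioMono.step` is just w ≤ 1, since c_0 = 1/2. -/
lemma LeftGood.op {x : Polynomial ℝ} (h : LeftGood x) {w : ℝ} (h0 : 0 ≤ w) (h1 : w ≤ 1) :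
    LeftGood (op w x) := by
  have hx0 : coeff 0 (ser 0 x u) = expect (u * x) := by
    rw [coeff_ser, pow_zero, Module.End.one_apply, mul_comm]
  have hn : 0 ≤ expect (u * x) := hx0 ▸ h.1
  have key := RatioMono.step h coeff_halfCatalan_pos coeff_halfCatalan_logConvex
    (κ := 2 * w * expect (u * x)) (by positivity)
    (by rw [coeff_halfCatalan_zero, hx0]; nlinarith)
  unfold LeftGood
  convert key using 2 with j
  rw [coeff_ser, coeff_ser, op_apply, op_zero_pow_apply, op_zero_pow_apply, add_mul, map_add,
    Algebra.smul_mul_assoc, map_smul, smul_eq_mul, ← expect_X_pow_mul_u_sq]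
  ring_nf

/-! ### The base profile -/

lemma profile_one : profile 1 = zeta := by rw [profile, intertwiner_one, zeta]

lemma zeta_rec (n : ℕ) : coeff (n + 1) halfCatalan =
    2 / 3 * coeff (n + 1) zeta + 2 / 9 * coeff n zeta := by
  rw [← profile_one, ← expect_u_mul_X_pow, ← expect_X_pow_mul_u, mul_one, mul_comm]

lemma zeta_zero : coeff 0 zeta = 1 / 4 := by
  rw [zeta, coeff_ser, pow_zero, Module.End.one_apply, φ, mul_sub, mul_one,
    Algebra.mul_smul_comm, map_sub, map_smul, expect_u, expect_u_sq]
  norm_num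

lemma zeta_one : coeff 1 zeta = 5 / 48 := by
  have h := zeta_rec 0
  rw [zero_add, coeff_halfCatalan_one, zeta_zero] at h
  linarith

lemma zeta_two : coeff 2 zeta = 17 / 288 := by
  have h := zeta_rec 1
  rw [coeff_halfCatalan_two, zeta_one] at h
  linarith

lemma zeta_step (j : ℕ) : (3 * coeff (j + 2) zeta + coeff (j + 1) zeta) * (2 * (j + 3)) =
    (2 * j + 3) * (3 * coeff (j + 1) zeta + coeff j zeta) := by
  have h := coeff_halfCatalan_succ (j + 1)
  rw [zeta_rec (j + 1), zeta_rec j] at h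
  push_cast at h
  linear_combination (9 / 2 : ℝ) * h

lemma zeta_three : coeff 3 zeta = 269 / 6912 := by
  have h := zeta_step 1
  rw [zeta_two, zeta_one] at h
  norm_num at h
  linarith

/-- The interval for the ratio of consecutive coefficients is chosen so that its upper end at j is
its lower end at j + 1; this gives log-convexity without a closed formula. -/
lemma zeta_bounds (j : ℕ) : 0 < coeff (j + 1) zeta ∧
    (2 * j + 3) * coeff (j + 1) zeta ≤ 2 * (j + 3) * coeff (j + 2) zeta ∧
    2 * (j + 4) * coeff (j + 2) zeta ≤ (2 * j + 5) * coeff (j + 1) zeta := by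
  -- The induction starts at 1 because its step uses 12j - 3 ≥ 0.
  rcases Nat.eq_zero_or_pos j with rfl | hj
  · rw [zeta_one, zeta_two]; norm_num
  induction j, hj using Nat.le_induction with
  | base => norm_num [zeta_three, zeta_two]
  | succ j hj ih =>
    obtain ⟨h1, h2, h3⟩ := ih
    have hj' : (1 : ℝ) ≤ j := by exact_mod_cast hj
    have h4 := zeta_step (j + 1)
    push_cast at h4 ⊢
    change (3 * coeff (j + 3) zeta + coeff (j + 2) zeta) * (2 * (↑j + 1 + 3)) =
      (2 * (↑j + 1) + 3) * (3 * coeff (j + 2) zeta + coeff (j + 1) zeta) at h4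
    change 0 < coeff (j + 2) zeta ∧ (2 * ((j : ℝ) + 1) + 3) * coeff (j + 2) zeta ≤
      2 * ((j : ℝ) + 1 + 3) * coeff (j + 3) zeta ∧
      2 * ((j : ℝ) + 1 + 4) * coeff (j + 3) zeta ≤ (2 * ((j : ℝ) + 1) + 5) * coeff (j + 2) zeta
    set p := coeff (j + 1) zeta
    set q := coeff (j + 2) zeta
    set r := coeff (j + 3) zeta
    have hq : 0 < q := by
      have : 0 < (2 * (j : ℝ) + 3) * p := by positivity
      nlinarith
    refine ⟨hq, ?_, ?_⟩
    · nlinarith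
    · have hpos : (0 : ℝ) < 3 * (j + 4) * (2 * j + 3) := by positivity
      refine le_of_mul_le_mul_left ?_ hpos
      have h5 := mul_le_mul_of_nonneg_left h2
        (show (0 : ℝ) ≤ (j + 5) * (2 * j + 5) by positivity)
      have h6 : 0 ≤ (12 * (j : ℝ) - 3) * q := mul_nonneg (by linarith) hq.le
      linear_combination h5 + h6 + (j + 5) * (2 * j + 3) * h4

lemma zeta_pos (j : ℕ) : 0 < coeff j zeta := by
  cases j with
  | zero => rw [zeta_zero]; norm_num
  | succ j => exact (zeta_bounds j).1

lemma zeta_logConvex (j : ℕ) :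
    coeff (j + 1) zeta * coeff (j + 1) zeta ≤ coeff j zeta * coeff (j + 2) zeta := by
  cases j with
  | zero => rw [zero_add, zero_add, zeta_zero, zeta_one, zeta_two]; norm_num
  | succ j =>
    obtain ⟨h1, -, h3⟩ := zeta_bounds j
    obtain ⟨h4, h5, -⟩ := zeta_bounds (j + 1)
    push_cast at h5
    change (2 * ((j : ℝ) + 1) + 3) * coeff (j + 2) zeta ≤
      2 * ((j : ℝ) + 1 + 3) * coeff (j + 3) zeta at h5
    change 0 < coeff (j + 2) zeta at h4
    change coeff (j + 2) zeta * coeff (j + 2) zeta ≤ coeff (j + 1) zeta * coeff (j + 3) zeta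
    have hpos : (0 : ℝ) < 2 * (j + 4) := by positivity
    refine le_of_mul_le_mul_left ?_ hpos
    have e1 := mul_le_mul_of_nonneg_right h3 h4.le
    have e2 := mul_le_mul_of_nonneg_left h5 h1.le
    linear_combination e1 + e2

/-- The analogue of `LeftGood` for vectors to the right of a gap. -/
structure RightGood (y : Polynomial ℝ) : Prop where
  nonneg : 0 ≤ expect (u * y)
  le_profile : 2 * expect (u * y) * coeff 0 zeta ≤ coeff 0 (profile y)
  mono : RatioMono (fun j => coeff j zeta) (fun j => coeff j (profile y))

lemma rightGood_one : RightGood 1 where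
  nonneg := by rw [mul_one, expect_u]; norm_num
  le_profile := by rw [mul_one, expect_u, profile_one]; norm_num
  mono := by
    rw [profile_one]
    exact ⟨(zeta_pos 0).le, fun j => le_of_eq (mul_comm _ _)⟩

lemma coeff_profile_op (w : ℝ) (y : Polynomial ℝ) (j : ℕ) :
    coeff j (profile (op w y)) = coeff (j + 1) (profile y) +
      2 * w * expect (u * y) * (coeff j zeta - coeff (j + 1) zeta) := by
  have h1 : intertwiner u = φ - op (1 / 9) φ := by
    have : u = 1 - Polynomial.X * 1 := by simp [u]
    rw [this, map_sub, intertwiner_X_mul, intertwiner_one]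
  rw [profile, op_apply, map_add, intertwiner_X_mul, map_smul, h1, ser_add_right, ser_smul_right,
    ser_sub_right, map_add, coeff_C_mul, map_sub, zeta, profile]
  simp only [coeff_ser, pow_succ, Module.End.mul_apply]

lemma RightGood.op {y : Polynomial ℝ} (h : RightGood y) {w : ℝ} (h0 : 0 ≤ w) (h1 : w ≤ 1) :
    RightGood (op w y) := by
  obtain ⟨hn, hle, hm⟩ := h
  have hκ : 2 * w * expect (u * y) * coeff 0 zeta ≤ coeff 0 (profile y) := by
    have := mul_nonneg hn (zeta_pos 0).le
    nlinarith
  have hstep := RatioMono.step hm zeta_pos zeta_logConvex (κ := 2 * w * expect (u * y))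
    (by positivity) hκ
  have hm0 := hm.1
  have hm1 := hm.nonneg zeta_pos 1
  have hm01 := hm.2 0
  simp only [zero_add, zeta_zero, zeta_one] at hm0 hm1 hm01 hκ
  have hκ0 : 0 ≤ 2 * w * expect (u * y) := by positivity
  have e : expect (u * CatalanRenewal.op w y) = 2 / 3 * coeff 1 (profile y) +
      2 / 9 * coeff 0 (profile y) + 2 * w * expect (u * y) * (3 / 8) := by
    have := expect_u_mul_X_pow 0 y
    rw [zero_add, pow_one] at this
    rw [op_apply, mul_add, map_add, this, Algebra.mul_smul_comm, map_smul, expect_u_sq,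
      smul_eq_mul]
  refine ⟨?_, ?_, ?_⟩
  · rw [e]; positivity
  -- With P_j the coefficients of the profile of y, the claim reduces to (2/3)P_1 - (1/9)P_0 ≥
  -- (w/12)⟨u, y⟩. It follows from P_1 ≥ (5/12)P_0 and w⟨u, y⟩ ≤ 2P_0, with equality at w = 1, y =
  -- 1.
  · rw [e, coeff_profile_op, zeta_zero, zero_add, zeta_one]
    linarith
  · convert hstep using 2 with j
    exact coeff_profile_op w y j

/-! ### Nonnegativity of the defect -/

lemma two_add_root_mul_inv : (2 + root) * (2 + root)⁻¹ = 1 :=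
  PowerSeries.mul_inv_cancel _ (by rw [map_add, constantCoeff_root, map_ofNat]; norm_num)

/-- Since 2 + root = 3 - λ h with h the halved Catalan series, the inverse solves a renewal equation
with nonnegative coefficients. -/
lemma coeff_two_add_root_inv_nonneg (n : ℕ) : 0 ≤ coeff n (2 + root)⁻¹ := by
  have h : (3 : ℝ⟦X⟧) * (2 + root)⁻¹ = 1 + halfCatalan * (2 + root)⁻¹ * X := by
    have := two_add_root_mul_inv
    unfold root at *
    linear_combination this
  induction n using Nat.strong_induction_on with
  | _ n ih =>
    have hn := congrArg (coeff n) h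
    rw [← map_ofNat (C : ℝ →+* ℝ⟦X⟧) 3, coeff_C_mul] at hn
    have : 0 ≤ coeff n (1 + halfCatalan * (2 + root)⁻¹ * X) := by
      cases n with
      | zero => simp
      | succ n =>
        rw [map_add, coeff_one, if_neg n.succ_ne_zero, zero_add, coeff_succ_mul_X, coeff_mul]
        refine Finset.sum_nonneg fun p hp => mul_nonneg (coeff_halfCatalan_pos _).le (ih _ ?_)
        have := Finset.HasAntidiagonal.mem_antidiagonal.mp hp
        omega
    rw [← hn] at this
    linarith

/-- The factor is 9 g · `ser 0 x u` up to its constant term, with g = 1 - 1/(2 + root). For x = 1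
the product of g with the comparison series is 1/(2 + root), so `coeff_mul_nonneg_of_ratioMono`
applies. -/
lemma left_factor_nonneg {x : Polynomial ℝ} (h : LeftGood x) (n : ℕ) :
    0 ≤ coeff n (2 * ((2 + root) * ser (1 / 9) x u - 3 * C (expect (x * u)))) := by
  have hr := two_add_root_mul_inv
  have e : 2 * ((2 + root) * ser (1 / 9) x u - 3 * C (expect (x * u))) =
      C (9 : ℝ) * ((1 - (2 + root)⁻¹) * ser 0 x u) - C (6 * expect (x * u)) := by
    have h1 := ser_ninth_u x
    rw [map_mul C 6, map_ofNat, map_ofNat]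
    linear_combination (2 + root)⁻¹ * h1 +
      (9 * ser 0 x u - 2 * (2 + root) * ser (1 / 9) x u) * hr
  rw [e, map_sub, coeff_C_mul, coeff_C]
  cases n with
  | zero =>
    have := congrArg constantCoeff hr
    rw [map_mul, map_add, constantCoeff_root, map_ofNat, map_one] at this
    have : constantCoeff (2 + root)⁻¹ = 1 / 3 := by linarith
    rw [if_pos rfl, coeff_zero_eq_constantCoeff_apply, map_mul, map_sub, map_one, this,
      constantCoeff_ser]
    linarith
  | succ n =>
    rw [if_neg n.succ_ne_zero, sub_zero]
    refine mul_nonneg (by norm_num) (coeff_mul_nonneg_of_ratioMono ?_ coeff_halfCatalan_pos h ?_)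
    · intro i
      rw [map_sub, coeff_one, if_neg i.succ_ne_zero, zero_sub]
      exact neg_nonpos.mpr (coeff_two_add_root_inv_nonneg _)
    · have : (1 - (2 + root)⁻¹) * halfCatalan = (2 + root)⁻¹ := by
        linear_combination (2 + root)⁻¹ * halfCatalan_mul - halfCatalan * hr
      rw [this]
      exact coeff_two_add_root_inv_nonneg _

/-- The multiplier (1 + root)(2 + root) has nonpositive coefficients beyond the constant one and
sends `zeta` to the constant 3/2. The correction to the profile contributes only at index zero,
where it cancels, and nonnegatively afterwards. -/
lemma right_factor_nonneg {y : Polynomial ℝ} (h : RightGood y) (n : ℕ) :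
    0 ≤ coeff n ((1 + root) * ((2 + root) * profile y - 3 * C (coeff 0 (profile y)))) := by
  set b := coeff 0 (profile y) with hb
  have hb0 : 0 ≤ b := h.mono.1
  have e : (1 + root) * ((2 + root) * profile y - 3 * C b) =
      (1 + root) * (2 + root) * profile y - C (6 * b) + C (3 * b) * (halfCatalan * X) := by
    rw [map_mul, map_mul, map_ofNat, map_ofNat]
    unfold root
    ring
  have hg : (1 + root) * (2 + root) = C (6 : ℝ) - C (3 : ℝ) * (halfCatalan * X) - X := by
    have := root_sq
    rw [map_ofNat, map_ofNat]
    linear_combination this + 3 * X_mul_halfCatalan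
  rw [e, map_add, map_sub, coeff_C, coeff_C_mul]
  cases n with
  | zero =>
    rw [if_pos rfl, coeff_zero_mul_X, mul_zero, add_zero, coeff_zero_eq_constantCoeff_apply,
      map_mul, map_mul, map_add, map_add, constantCoeff_root, map_one, map_ofNat,
      ← coeff_zero_eq_constantCoeff_apply (profile y), ← hb]
    linarith
  | succ n =>
    rw [if_neg n.succ_ne_zero, sub_zero, coeff_succ_mul_X]
    have h1 := coeff_halfCatalan_pos n
    refine add_nonneg ?_ (by positivity)
    refine coeff_mul_nonneg_of_ratioMono ?_ zeta_pos h.mono ?_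
    · intro i
      have h2 := coeff_halfCatalan_pos i
      rw [hg, map_sub, map_sub, coeff_C, if_neg i.succ_ne_zero, coeff_C_mul, coeff_succ_mul_X,
        coeff_X]
      split_ifs <;> linarith
    · have : (1 + root) * (2 + root) * zeta = C (3 / 2 : ℝ) := by
        have h3 := zeta_mul
        have h4 : (2 : ℝ⟦X⟧) * C (3 / 2 : ℝ) = 3 := C_mul_ofNat (by norm_num)
        have h5 : (2 : ℝ⟦X⟧) ≠ 0 := by
          rw [← map_ofNat (C : ℝ →+* ℝ⟦X⟧) 2]; simp
        apply mul_left_cancel₀ h5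
        linear_combination h3 - h4
      rw [this, coeff_C, if_neg n.succ_ne_zero]

lemma defect_nonneg {x y : Polynomial ℝ} (hx : LeftGood x) (hy : RightGood y) (n : ℕ) :
    expect (x * op (1 / 3) ((op 1 ^ n) (op (1 / 3) (intertwiner y)))) ≤
      expect (x * intertwiner ((op 1 ^ (n + 1)) (Polynomial.X * y))) := by
  rw [← sub_nonneg]
  have h := congrArg (coeff (n + 2)) (defect_eq x y)
  rw [show ∀ a b : ℝ⟦X⟧, 4 * a * b = C (2 : ℝ) * ((2 * a) * b) by
      intro a b; rw [map_ofNat]; ring, coeff_C_mul, mul_comm (X ^ 2),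
    ← map_ofNat (C : ℝ →+* ℝ⟦X⟧) 81, coeff_C_mul, coeff_mul_X_pow, defect, coeff_mk] at h
  have h2 : 0 ≤ coeff (n + 2) (2 * ((2 + root) * ser (1 / 9) x u - 3 * C (expect (x * u))) *
      ((1 + root) * ((2 + root) * profile y - 3 * C (coeff 0 (profile y))))) := by
    rw [coeff_mul]
    exact Finset.sum_nonneg fun p _ =>
      mul_nonneg (left_factor_nonneg hx _) (right_factor_nonneg hy _)
  linarith

/-! ### Words -/

/-- The vector of the event that the renewal set avoids the marked sites of a word. -/
noncomputable def avoid : List Bool → Polynomial ℝ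
  | [] => 1
  | b :: l => op (if b then 0 else 1) (avoid l)

/-- The probability that a site is not marked, given its two parents. -/
noncomputable def siteWeight (a b : Bool) : ℝ := (1 / 3) ^ (a.toNat + b.toNat)

/-- The averaged vector after one step of the growth model; `prev` is the mark to the left. -/
noncomputable def evolved : Bool → List Bool → Polynomial ℝ
  | prev, [] => op (siteWeight prev false) 1
  | prev, b :: l => op (siteWeight prev b) (evolved b l)

lemma rightGood_avoid (l : List Bool) : RightGood (avoid l) := by
  induction l with
  | nil => exact rightGood_one
  | cons b l ih => cases b <;> exact ih.op (by simp) (by simp)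

lemma op_one_pow_one (n : ℕ) : (op 1 ^ n) (1 : Polynomial ℝ) = 1 := by
  induction n with
  | zero => rfl
  | succ n ih => rw [pow_succ, Module.End.mul_apply, op_one_one, ih]

lemma LeftGood.op_one_pow {x : Polynomial ℝ} (h : LeftGood x) (n : ℕ) :
    LeftGood ((CatalanRenewal.op 1 ^ n) x) := by
  induction n with
  | zero => exact h
  | succ n ih =>
    rw [pow_succ', Module.End.mul_apply]
    exact ih.op zero_le_one le_rfl

lemma siteWeight_true_true : siteWeight true true = 1 / 9 := by norm_num [siteWeight]
lemma siteWeight_true_false : siteWeight true false = 1 / 3 := by norm_num [siteWeight]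
lemma siteWeight_false_true : siteWeight false true = 1 / 3 := by norm_num [siteWeight]
lemma siteWeight_false_false : siteWeight false false = 1 := by norm_num [siteWeight]

/-- The induction needs arbitrary good test vectors on the left and two boundary states: directly
after a mark, or after a mark followed by n + 1 unmarked sites. Operators reached on the way are
moved onto x, which stays good; when a gap closes, the comparison is `defect_nonneg`. -/
lemma expect_evolved_le_intertwiner (l : List Bool) :
    (∀ x, LeftGood x → expect (x * evolved true l) ≤ expect (x * intertwiner (avoid l))) ∧
    (∀ x, LeftGood x → ∀ n, expect (x * op (1 / 3) ((op 1 ^ n) (evolved false l))) ≤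
      expect (x * intertwiner ((op 1 ^ (n + 1)) (avoid l)))) := by
  induction l with
  | nil =>
    refine ⟨fun x _ => ?_, fun x _ n => ?_⟩
    · rw [evolved, siteWeight_true_false, op_third_one, avoid, intertwiner_one]
    · rw [evolved, siteWeight_false_false, op_one_one, op_one_pow_one, op_third_one, avoid,
        op_one_pow_one, intertwiner_one]
  | cons b l ih =>
    obtain ⟨ih1, ih2⟩ := ih
    cases b with
    | false =>
      refine ⟨fun x hx => ?_, fun x hx n => ?_⟩
      · rw [evolved, siteWeight_true_false]
        exact ih2 x hx 0
      · rw [evolved, siteWeight_false_false, avoid, ← Module.End.mul_apply (op 1 ^ n),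
          ← Module.End.mul_apply (op 1 ^ (n + 1)), ← pow_succ]
        exact ih2 x hx (n + 1)
    | true =>
      refine ⟨fun x hx => ?_, fun x hx n => ?_⟩
      · rw [evolved, siteWeight_true_true, expect_op_symm]
        refine (ih1 _ (hx.op (by norm_num) (by norm_num))).trans (le_of_eq ?_)
        rw [← expect_op_symm, ← intertwiner_X_mul, ← op_zero_apply]
        rfl
      · rw [evolved, siteWeight_false_true, expect_op_symm, expect_op_pow_symm, expect_op_symm]
        refine (ih1 _ (((hx.op (by norm_num) (by norm_num)).op_one_pow n).op
          (by norm_num) (by norm_num))).trans ?_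
        rw [← expect_op_symm, ← expect_op_pow_symm, ← expect_op_symm]
        refine (defect_nonneg hx (rightGood_avoid l) n).trans (le_of_eq ?_)
        rw [← op_zero_apply]
        rfl

/-- One step of the growth model does not increase the expected avoidance probability. -/
theorem expect_evolved_le (l : List Bool) : expect (evolved false l) ≤ expect (avoid l) := by
  have hS : ∀ z, expect (op 1 z) = expect z := fun z => by
    rw [← one_mul (op 1 z), expect_op_symm, op_one_one, one_mul]
  induction l with
  | nil => rw [evolved, siteWeight_false_false, hS]; rfl
  | cons b l ih =>
    cases b with
    | false =>
      rw [evolved, siteWeight_false_false, hS]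
      exact ih.trans (le_of_eq (hS _).symm)
    | true =>
      rw [evolved, siteWeight_false_true, ← one_mul (op _ _), expect_op_symm]
      refine ((expect_evolved_le_intertwiner l).1 _
        (leftGood_one.op (by norm_num) (by norm_num))).trans (le_of_eq ?_)
      -- The leftmost evolved site turns 1 into φ = V1, so the pairing collapses by ⟨V1, Vy⟩ = ⟨t,
      -- y⟩.
      rw [op_third_one, ← intertwiner_one, expect_intertwiner_mul, mul_one, ← op_zero_apply]
      rfl

theorem expect_avoid_nonneg (l : List Bool) : 0 ≤ expect (avoid l) := by
  -- Induction along the word needs the powers of t, because a marked site multiplies by t.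
  suffices h : ∀ n, 0 ≤ expect (Polynomial.X ^ n * avoid l) by simpa using h 0
  induction l with
  | nil =>
    intro n
    rw [avoid, mul_one, expect_X_pow]
    have h : root * root⁻¹ = 1 := PowerSeries.mul_inv_cancel _ (by simp [constantCoeff_root])
    have h' : root⁻¹ = 1 + halfCatalan * root⁻¹ * X := by
      unfold root at *
      linear_combination h
    induction n using Nat.strong_induction_on with
    | _ n ih =>
      rw [h']
      cases n with
      | zero => simp
      | succ n =>
        rw [map_add, coeff_one, if_neg n.succ_ne_zero, zero_add, coeff_succ_mul_X, coeff_mul]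
        refine Finset.sum_nonneg fun p hp => mul_nonneg (coeff_halfCatalan_pos _).le (ih _ ?_)
        have := Finset.HasAntidiagonal.mem_antidiagonal.mp hp
        omega
  | cons b l ih =>
    intro n
    have h1 := (rightGood_avoid l).nonneg
    have h2 := coeff_halfCatalan_pos n
    rw [avoid, op_apply, mul_add, map_add, Algebra.mul_smul_comm, map_smul, expect_X_pow_mul_u,
      ← mul_assoc, ← pow_succ, smul_eq_mul]
    refine add_nonneg (ih _) (mul_nonneg (mul_nonneg ?_ h1) h2.le)
    split_ifs <;> norm_num

theorem expect_avoid_false (l : List Bool) (h : ∀ b ∈ l, b = false) : expect (avoid l) = 1 := by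
  have : avoid l = 1 := by
    induction l with
    | nil => rfl
    | cons b l ih =>
      rw [avoid, ih fun b hb => h b (List.mem_cons_of_mem _ hb), h b (List.mem_cons_self ..)]
      exact op_one_one
  rw [this, expect_one]

theorem expect_avoid_true : expect (avoid [true]) = 1 / 2 := by
  have h := expect_u
  rw [u, map_sub, expect_one] at h
  have : avoid [true] = Polynomial.X := by
    rw [avoid, avoid, if_pos rfl, op_zero_apply, mul_one]
  rw [this]
  linarith

end CatalanRenewal

namespace OrientedPercolation

open MeasureTheory ProbabilityTheory

/-! ### Independent coins and adapted sampling -/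

section Coins

variable {ι : Type*}

/-- Independent coins indexed by `ι`. -/
noncomputable abbrev coins (ι : Type*) (p : unitInterval) : Measure (ι → Bool) :=
  Measure.infinitePi fun _ : ι => bernoulliMeasure true false p

/-- The σ-algebra generated by the coordinates in `S`. -/
@[reducible] def coordAlg (S : Set ι) : MeasurableSpace (ι → Bool) :=
  ⨆ e ∈ S, MeasurableSpace.comap (fun ω : ι → Bool => ω e) ⊤

lemma coordAlg_le (S : Set ι) : coordAlg S ≤ MeasurableSpace.pi :=
  iSup₂_le fun e _ => (measurable_pi_apply e).comap_le

lemma coordAlg_mono {S T : Set ι} (h : S ⊆ T) : coordAlg S ≤ coordAlg T :=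
  biSup_mono h

lemma measurableSet_coord {S : Set ι} {e : ι} (he : e ∈ S) (b : Bool) :
    MeasurableSet[coordAlg S] {ω : ι → Bool | ω e = b} :=
  le_iSup₂ (f := fun e (_ : e ∈ S) => MeasurableSpace.comap (fun ω : ι → Bool => ω e) ⊤) e he _
    ⟨{b}, trivial, rfl⟩

lemma measurableSet_exists_open (K : Finset ι) :
    MeasurableSet[coordAlg (K : Set ι)] {ω : ι → Bool | ∃ e ∈ K, ω e = true} := by
  have : {ω : ι → Bool | ∃ e ∈ K, ω e = true} = ⋃ e ∈ K, {ω | ω e = true} := by ext; simp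
  rw [this]
  exact @Finset.measurableSet_biUnion _ _ (coordAlg (K : Set ι)) _ _
    fun e he => measurableSet_coord (Finset.mem_coe.mpr he) true

lemma indep_coordAlg (p : unitInterval) {S T : Set ι} (h : Disjoint S T) :
    Indep (coordAlg S) (coordAlg T) (coins ι p) := by
  have hi : iIndepFun (fun (e : ι) (ω : ι → Bool) => ω e) (coins ι p) :=
    iIndepFun_infinitePi (X := fun _ b => b) fun _ => measurable_id
  exact indep_iSup_of_disjoint (fun e => (measurable_pi_apply e).comap_le) hi h

lemma coins_inter (p : unitInterval) {S T : Set ι} (h : Disjoint S T) {A B : Set (ι → Bool)}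
    (hA : MeasurableSet[coordAlg S] A) (hB : MeasurableSet[coordAlg T] B) :
    (coins ι p).real (A ∩ B) = (coins ι p).real A * (coins ι p).real B := by
  have := (Indep_iff _ _ _).mp (indep_coordAlg p h) A B hA hB
  rw [measureReal_def, this, ENNReal.toReal_mul]
  rfl

lemma coins_biInter {κ : Type*} (p : unitInterval) (s : Finset κ) (S : κ → Set ι)
    (A : κ → Set (ι → Bool)) (hS : ∀ i ∈ s, ∀ j ∈ s, i ≠ j → Disjoint (S i) (S j))
    (hA : ∀ i ∈ s, MeasurableSet[coordAlg (S i)] (A i)) :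
    MeasurableSet[coordAlg (⋃ i ∈ s, S i)] (⋂ i ∈ s, A i) ∧
      (coins ι p).real (⋂ i ∈ s, A i) = ∏ i ∈ s, (coins ι p).real (A i) := by
  classical
  induction s using Finset.induction_on with
  | empty =>
    refine ⟨?_, by simp⟩
    simp only [Finset.notMem_empty, Set.iInter_of_empty, Set.iInter_univ]
    exact @MeasurableSet.univ _ (coordAlg _)
  | insert a s ha ih =>
    obtain ⟨ih1, ih2⟩ := ih
      (fun i hi j hj => hS i (Finset.mem_insert_of_mem hi) j (Finset.mem_insert_of_mem hj))
      (fun i hi => hA i (Finset.mem_insert_of_mem hi))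
    have hAa := hA a (Finset.mem_insert_self a s)
    rw [Finset.set_biInter_insert, Finset.set_biUnion_insert, Finset.prod_insert ha]
    refine ⟨@MeasurableSet.inter _ (coordAlg _) _ _
      (coordAlg_mono Set.subset_union_left _ hAa) (coordAlg_mono Set.subset_union_right _ ih1), ?_⟩
    rw [coins_inter p ?_ hAa ih1, ih2]
    refine Set.disjoint_iUnion₂_right.mpr fun j hj => hS a (Finset.mem_insert_self a s) j
      (Finset.mem_insert_of_mem hj) ?_
    rintro rfl
    exact ha hj

lemma coins_real_coord (p : unitInterval) (e : ι) (b : Bool) :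
    (coins ι p).real {ω | ω e = b} = if b then (p : ℝ) else 1 - p := by
  have h : (coins ι p).real {ω | ω e = b} = (bernoulliMeasure true false p).real {b} := by
    rw [← Measure.infinitePi_map_eval (fun _ : ι => bernoulliMeasure true false p) e,
      map_measureReal_apply (measurable_pi_apply e) (measurableSet_singleton b)]
    rfl
  rw [h]
  classical
  rw [bernoulliMeasure_real_apply p (measurableSet_singleton b)]
  cases b <;> simp

lemma coins_forall_eq (p : unitInterval) (K : Finset ι) (b : Bool) :
    (coins ι p).real {ω | ∀ e ∈ K, ω e = b} = (if b then (p : ℝ) else 1 - p) ^ K.card := by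
  have : {ω : ι → Bool | ∀ e ∈ K, ω e = b} = ⋂ e ∈ K, {ω | ω e = b} := by ext; simp
  rw [this, (coins_biInter p K (fun e => {e}) _ (fun i _ j _ h => by simpa using h)
    (fun e _ => measurableSet_coord (Set.mem_singleton e) b)).2]
  simp only [coins_real_coord, Finset.prod_const]

lemma coins_forall_closed (p : unitInterval) (K : Finset ι) :
    (coins ι p).real {ω | ∀ e ∈ K, ω e = false} = (1 - p) ^ K.card := by
  rw [coins_forall_eq]; simp

lemma coins_forall_open (p : unitInterval) (K : Finset ι) :
    (coins ι p).real {ω | ∀ e ∈ K, ω e = true} = (p : ℝ) ^ K.card := by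
  rw [coins_forall_eq]; simp

lemma coins_exists_open (p : unitInterval) (K : Finset ι) :
    (coins ι p).real {ω | ∃ e ∈ K, ω e = true} = 1 - (1 - p) ^ K.card := by
  have hm := coordAlg_le _ _ (measurableSet_exists_open K)
  have : {ω : ι → Bool | ∀ e ∈ K, ω e = false} = {ω | ∃ e ∈ K, ω e = true}ᶜ := by ext; simp
  rw [← coins_forall_closed, this, probReal_compl_eq_one_sub hm]
  ring

lemma real_preimage_eq_bernoulli {Ω : Type*} [MeasurableSpace Ω] (μ : Measure Ω)
    [IsProbabilityMeasure μ] (q : unitInterval) {A : Set Ω} (hA : MeasurableSet A)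
    (hq : μ.real A = q) (f : Ω → Bool) (hf : ∀ ω, f ω = true ↔ ω ∈ A) (t : Set Bool) :
    μ.real (f ⁻¹' t) = (bernoulliMeasure true false q).real t := by
  classical
  rw [bernoulliMeasure_real_apply q t.toFinite.measurableSet]
  have hf' : ∀ ω, f ω = false ↔ ω ∈ Aᶜ := fun ω => by
    rw [Set.mem_compl_iff, ← hf]; simp
  by_cases h1 : true ∈ t <;> by_cases h2 : false ∈ t
  · have : f ⁻¹' t = Set.univ := by
      ext ω; cases h : f ω <;> simp [h, h1, h2]
    simp [h1, h2, this]
  · have : f ⁻¹' t = A := by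
      ext ω; rw [← hf]; cases h : f ω <;> simp [h, h1, h2]
    simp [h1, h2, this, hq]
  · have : f ⁻¹' t = Aᶜ := by
      ext ω; rw [← hf']; cases h : f ω <;> simp [h, h1, h2]
    simp [h1, h2, this, probReal_compl_eq_one_sub hA, hq]
  · have : f ⁻¹' t = ∅ := by
      ext ω; cases h : f ω <;> simp [h, h1, h2]
    simp [h1, h2, this]

/-- Sampling disjoint cells of coins in an adapted way produces independent coins: the choice
`σ f` of the cell `K f (σ f)` only looks at the coins in `past (lev f)`. -/
theorem map_adapted_coins {J N : Type*} [Fintype N] (p q : unitInterval) (lev : J → ℕ)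
    (past : ℕ → Set ι) (hpast : Monotone past) (K : J → N → Finset ι) (σ : J → (ι → Bool) → N)
    (hσ : ∀ f v, MeasurableSet[coordAlg (past (lev f))] {ω | σ f ω = v})
    (hK : ∀ f v, Disjoint (past (lev f)) (K f v : Set ι))
    (hKK : ∀ f g, f ≠ g → ∀ v w, Disjoint (K f v : Set ι) (K g w))
    (hcard : ∀ f v, 1 - (1 - (p : ℝ)) ^ (K f v).card = q)
    (Φ : (ι → Bool) → J → Bool) (hΦ : ∀ ω f, Φ ω f = true ↔ ∃ e ∈ K f (σ f ω), ω e = true) :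
    Measurable Φ ∧ (coins ι p).map Φ = coins J q := by
  classical
  have hmeas : ∀ f (t : Set Bool), MeasurableSet[coordAlg (past (lev f) ∪ ⋃ v, (K f v : Set ι))]
      {ω | Φ ω f ∈ t} := by
    intro f t
    have e : {ω | Φ ω f ∈ t} =
        ⋃ v, ({ω | σ f ω = v} ∩ {ω | decide (∃ e ∈ K f v, ω e = true) ∈ t}) := by
      ext ω
      have : Φ ω f = decide (∃ e ∈ K f (σ f ω), ω e = true) := by
        rw [Bool.eq_iff_iff, hΦ, decide_eq_true_iff]
      simp [this]
    rw [e]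
    refine @MeasurableSet.iUnion _ _ (coordAlg _) _ _ fun v =>
      @MeasurableSet.inter _ (coordAlg _) _ _ (coordAlg_mono Set.subset_union_left _ (hσ f v)) ?_
    refine coordAlg_mono ((Set.subset_iUnion (fun v => (K f v : Set ι)) v).trans
      Set.subset_union_right) _ ?_
    have h := measurableSet_exists_open (K f v)
    have : Measurable[coordAlg (K f v : Set ι)]
        (fun ω : ι → Bool => decide (∃ e ∈ K f v, ω e = true)) := by
      refine @measurable_to_bool _ (coordAlg (K f v : Set ι)) _ ?_
      convert h using 1
      ext ω; simp
    exact this (Set.toFinite t).measurableSet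
  have hΦm : Measurable Φ := measurable_pi_lambda _ fun f t _ => coordAlg_le _ _ (hmeas f t)
  refine ⟨hΦm, Measure.eq_infinitePi _ fun s t _ => ?_⟩
  have hbox : MeasurableSet (Set.pi (s : Set J) t) :=
    MeasurableSet.pi s.countable_toSet fun i _ => (Set.toFinite _).measurableSet
  rw [Measure.map_apply hΦm hbox, ← ENNReal.toReal_eq_toReal_iff' (measure_ne_top _ _)
    (ENNReal.prod_ne_top fun i _ => measure_ne_top _ _), ENNReal.toReal_prod]
  have hpre : Φ ⁻¹' Set.pi (s : Set J) t = ⋂ f ∈ s, {ω | Φ ω f ∈ t f} := by ext; simp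
  rw [hpre]
  change (coins ι p).real _ = ∏ f ∈ s, (bernoulliMeasure true false q).real (t f)
  clear hpre hbox
  -- Adding an index of maximal level last puts the earlier cells and the data for the new choice
  -- among coins disjoint from every candidate for the new cell.
  induction s using Finset.induction_on_max_value lev with
  | empty => simp
  | insert f s hf hlev ih =>
    set A := ⋂ g ∈ s, {ω | Φ ω g ∈ t g} with hA
    have hAm : MeasurableSet[coordAlg (past (lev f) ∪ ⋃ g ∈ s, ⋃ v, (K g v : Set ι))] A := by
      refine @Finset.measurableSet_biInter _ _ (coordAlg _) _ _ fun g hg => ?_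
      refine coordAlg_mono (Set.union_subset_union (hpast (hlev g hg)) ?_) _ (hmeas g (t g))
      exact Set.subset_biUnion_of_mem (u := fun g => ⋃ v, (K g v : Set ι)) hg
    rw [Finset.set_biInter_insert, Finset.prod_insert hf, ← ih, Set.inter_comm]
    have hsplit : ∀ B : Set (ι → Bool), MeasurableSet B →
        (coins ι p).real B = ∑ v, (coins ι p).real (B ∩ {ω | σ f ω = v}) := by
      intro B hB
      rw [← measureReal_biUnion_finset]
      · congr 1; ext ω; simp
      · intro v _ w _ hvw
        refine Set.disjoint_left.mpr ?_
        rintro ω ⟨-, h1⟩ ⟨-, h2⟩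
        exact hvw (h1.symm.trans h2)
      · exact fun v _ => hB.inter (coordAlg_le _ _ (hσ f v))
    have hAm' := coordAlg_le _ _ hAm
    -- Once the chosen value v is fixed, the new cell is deterministic and independent of the rest,
    -- and its law does not depend on v.
    rw [hsplit _ (hAm'.inter (coordAlg_le _ _ (hmeas f (t f)))), hsplit A hAm', Finset.mul_sum]
    refine Finset.sum_congr rfl fun v _ => ?_
    set B := {ω : ι → Bool | decide (∃ e ∈ K f v, ω e = true) ∈ t f} with hB
    have hBm : MeasurableSet[coordAlg (K f v : Set ι)] B := by
      have : Measurable[coordAlg (K f v : Set ι)]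
          (fun ω : ι → Bool => decide (∃ e ∈ K f v, ω e = true)) := by
        refine @measurable_to_bool _ (coordAlg (K f v : Set ι)) _ ?_
        convert measurableSet_exists_open (K f v) using 1
        ext ω; simp
      exact this (Set.toFinite (t f)).measurableSet
    have e1 : A ∩ {ω | Φ ω f ∈ t f} ∩ {ω | σ f ω = v} = A ∩ {ω | σ f ω = v} ∩ B := by
      ext ω
      have : Φ ω f = decide (∃ e ∈ K f (σ f ω), ω e = true) := by
        rw [Bool.eq_iff_iff, hΦ, decide_eq_true_iff]
      constructor
      · rintro ⟨⟨h1, h2⟩, h3⟩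
        refine ⟨⟨h1, h3⟩, ?_⟩
        rw [Set.mem_ofPred_eq, this, h3] at h2
        exact h2
      · rintro ⟨⟨h1, h3⟩, h2⟩
        refine ⟨⟨h1, ?_⟩, h3⟩
        rw [Set.mem_ofPred_eq, this, h3]
        exact h2
    have hdisj : Disjoint (past (lev f) ∪ ⋃ g ∈ s, ⋃ v, (K g v : Set ι)) (K f v : Set ι) := by
      refine Set.disjoint_union_left.mpr ⟨hK f v, ?_⟩
      refine Set.disjoint_iUnion₂_left.mpr fun g hg => Set.disjoint_iUnion_left.mpr fun w => ?_
      exact hKK g f (fun h => hf (h ▸ hg)) w v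
    have hBq : (coins ι p).real B = (bernoulliMeasure true false q).real (t f) :=
      real_preimage_eq_bernoulli (coins ι p) q (coordAlg_le _ _ (measurableSet_exists_open (K f v)))
        (by rw [coins_exists_open, hcard]) _ (fun ω => by simp) (t f)
    rw [e1, coins_inter p hdisj ?_ hBm, hBq, mul_comm]
    exact @MeasurableSet.inter _ (coordAlg _) _ _ hAm
      (coordAlg_mono Set.subset_union_left _ (hσ f v))

end Coins

end OrientedPercolation

/-! ### Averaging the avoidance vector over random marks -/

namespace CatalanRenewal

lemma op_eq_convex (w : ℝ) (y : Polynomial ℝ) :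
    op w y = (1 - w) • op 0 y + w • op 1 y := by
  simp only [op_apply]
  module

/-- The probability of the mark `b` at a site which is unmarked with probability `w`. -/
noncomputable def markProb (w : ℝ) (b : Bool) : ℝ := if b then 1 - w else w

/-- The product of the operators `op (w i)`, `i < k`, applied to `1`. -/
noncomputable def opWord (w : ℕ → ℝ) : ℕ → Polynomial ℝ
  | 0 => 1
  | k + 1 => op (w 0) (opWord (fun i => w (i + 1)) k)

/-- The avoidance vector is affine in each site operator, so averaging over independent marks
replaces each operator by its mean, which is again of the form `op w`. -/
lemma sum_avoid (k : ℕ) (w : ℕ → ℝ) :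
    ∑ B : Fin k → Bool, (∏ i : Fin k, markProb (w i) (B i)) • avoid (List.ofFn B) = opWord w k := by
  induction k generalizing w with
  | zero => simp [avoid, opWord]
  | succ k ih =>
    rw [← (Fin.consEquiv fun _ => Bool).sum_comp, Fintype.sum_prod_type, Fintype.sum_bool, opWord,
      ← ih, map_sum, ← Finset.sum_add_distrib]
    refine Finset.sum_congr rfl fun B _ => ?_
    rw [map_smul, op_eq_convex]
    simp only [Fin.consEquiv_apply, Fin.prod_univ_succ, Fin.cons_zero, Fin.cons_succ, Fin.val_zero,
      Fin.val_succ, List.ofFn_succ, avoid, markProb, if_true, Bool.false_eq_true, if_false]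
    module

lemma evolved_eq_opWord (prev : Bool) (l : List Bool) :
    evolved prev l = opWord (fun i => siteWeight ((prev :: l).getD i false) (l.getD i false))
      (l.length + 1) := by
  induction l generalizing prev with
  | nil => simp [evolved, opWord]
  | cons b l ih =>
    rw [evolved, ih, List.length_cons]
    rfl

end CatalanRenewal

namespace OrientedPercolation

open MeasureTheory ProbabilityTheory CatalanRenewal

/-! ### Levels of the quadrant -/

/-- The edge from `(a, b)` to `(a + 1, b)`. -/
def rightEdge (a b : ℕ) : quadrantEdges := ⟨((a, b), (a + 1, b)), Or.inl rfl⟩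

/-- The edge from `(a, b)` to `(a, b + 1)`. -/
def upEdge (a b : ℕ) : quadrantEdges := ⟨((a, b), (a, b + 1)), Or.inr rfl⟩

/-- The vertex `(a, b)` is reached from the origin. -/
def Reached (ω : Config quadrantEdges) (a b : ℕ) : Prop := (a, b) ∈ cluster quadrantEdges ω (0, 0)

lemma reached_iff (ω : Config quadrantEdges) (a b : ℕ) : Reached ω a b ↔
    (a = 0 ∧ b = 0) ∨ (∃ a', a = a' + 1 ∧ Reached ω a' b ∧ ω (rightEdge a' b) = true) ∨
      ∃ b', b = b' + 1 ∧ Reached ω a b' ∧ ω (upEdge a b') = true := by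
  constructor
  · intro h
    rcases Relation.ReflTransGen.cases_tail h with h | ⟨⟨c, d⟩, h1, h2, h3⟩
    · left; simpa using h
    · rcases h2 with h2 | h2
      · obtain ⟨rfl, rfl⟩ : a = c + 1 ∧ b = d := by simpa using h2
        exact Or.inr (Or.inl ⟨c, rfl, h1, h3⟩)
      · obtain ⟨rfl, rfl⟩ : a = c ∧ b = d + 1 := by simpa using h2
        exact Or.inr (Or.inr ⟨d, rfl, h1, h3⟩)
  · rintro (⟨rfl, rfl⟩ | ⟨a', rfl, h1, h2⟩ | ⟨b', rfl, h1, h2⟩)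
    · exact Relation.ReflTransGen.refl
    · exact Relation.ReflTransGen.tail h1 ⟨(rightEdge a' b).2, h2⟩
    · exact Relation.ReflTransGen.tail h1 ⟨(upEdge a b').2, h2⟩

/-- The edges whose source has level less than `n`. -/
def edgesBelow (n : ℕ) : Set quadrantEdges := {e | e.1.1.1 + e.1.1.2 < n}

lemma measurableSet_reached (a b : ℕ) :
    MeasurableSet[coordAlg (edgesBelow (a + b))] {ω | Reached ω a b} := by
  induction hn : a + b generalizing a b with
  | zero =>
    obtain ⟨rfl, rfl⟩ : a = 0 ∧ b = 0 := by omega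
    have : {ω | Reached ω 0 0} = Set.univ :=
      Set.eq_univ_of_forall fun ω => (reached_iff ω 0 0).mpr (Or.inl ⟨rfl, rfl⟩)
    rw [this]
    exact @MeasurableSet.univ _ (coordAlg _)
  | succ n ih =>
    have hsub : edgesBelow n ⊆ edgesBelow (n + 1) := fun e (he : _ < n) => Nat.lt_succ_of_lt he
    have h1 : ∀ a', MeasurableSet[coordAlg (edgesBelow (n + 1))]
        {ω | a = a' + 1 ∧ Reached ω a' b ∧ ω (rightEdge a' b) = true} := by
      intro a'
      by_cases h : a = a' + 1
      · simp only [h, true_and]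
        refine @MeasurableSet.inter _ (coordAlg _) _ _
          (coordAlg_mono hsub _ (ih a' b (by omega))) (measurableSet_coord ?_ true)
        change a' + b < n + 1
        omega
      · simp only [h, false_and]
        exact @MeasurableSet.empty _ (coordAlg _)
    have h2 : ∀ b', MeasurableSet[coordAlg (edgesBelow (n + 1))]
        {ω | b = b' + 1 ∧ Reached ω a b' ∧ ω (upEdge a b') = true} := by
      intro b'
      by_cases h : b = b' + 1
      · simp only [h, true_and]
        refine @MeasurableSet.inter _ (coordAlg _) _ _
          (coordAlg_mono hsub _ (ih a b' (by omega))) (measurableSet_coord ?_ true)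
        change a + b' < n + 1
        omega
      · simp only [h, false_and]
        exact @MeasurableSet.empty _ (coordAlg _)
    have e : {ω | Reached ω a b} =
        (⋃ a', {ω | a = a' + 1 ∧ Reached ω a' b ∧ ω (rightEdge a' b) = true}) ∪
          ⋃ b', {ω | b = b' + 1 ∧ Reached ω a b' ∧ ω (upEdge a b') = true} := by
      ext ω
      have : ¬ (a = 0 ∧ b = 0) := by omega
      simp only [Set.mem_ofPred_eq, reached_iff ω a b, this, false_or, Set.mem_union,
        Set.mem_iUnion]
    rw [e]
    exact @MeasurableSet.union _ (coordAlg _) _ _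
      (@MeasurableSet.iUnion _ _ (coordAlg _) _ _ h1)
      (@MeasurableSet.iUnion _ _ (coordAlg _) _ _ h2)

/-- Some vertex of level `n` is reached. -/
def Alive (ω : Config quadrantEdges) (n : ℕ) : Prop := ∃ a ≤ n, Reached ω a (n - a)

lemma Reached.alive {ω : Config quadrantEdges} {a b : ℕ} (h : Reached ω a b) : Alive ω (a + b) :=
  ⟨a, by omega, by rwa [Nat.add_sub_cancel_left]⟩

lemma Alive.pred {ω : Config quadrantEdges} {n : ℕ} (h : Alive ω (n + 1)) : Alive ω n := by
  obtain ⟨a, ha, h⟩ := h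
  rcases (reached_iff _ _ _).mp h with h | ⟨a', rfl, h, -⟩ | ⟨b', hb, h, -⟩
  · omega
  · have := h.alive
    rwa [show a' + (n + 1 - (a' + 1)) = n by omega] at this
  · have := h.alive
    rwa [show a + b' = n by omega] at this

lemma Alive.anti {ω : Config quadrantEdges} {m n : ℕ} (hmn : m ≤ n) (h : Alive ω n) :
    Alive ω m := by
  induction n, hmn using Nat.le_induction with
  | base => exact h
  | succ n _ ih => exact ih h.pred

lemma infinite_iff_alive (ω : Config quadrantEdges) :
    (cluster quadrantEdges ω (0, 0)).Infinite ↔ ∀ n, Alive ω n := by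
  constructor
  · intro h n
    by_contra hn
    refine h (((Finset.range n ×ˢ Finset.range n).finite_toSet).subset ?_)
    rintro ⟨a, b⟩ hab
    have h1 : Alive ω (a + b) := Reached.alive hab
    have h2 : a + b < n := by
      by_contra h3
      exact hn (h1.anti (by omega))
    simp only [Finset.coe_product, Finset.coe_range, Set.mem_prod, Set.mem_Iio]
    omega
  · intro h hfin
    obtain ⟨N, hN⟩ := (hfin.image fun v : ℕ × ℕ => v.1 + v.2).bddAbove
    obtain ⟨a, ha, h1⟩ := h (N + 1)
    have := hN ⟨(a, N + 1 - a), h1, rfl⟩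
    simp only at this
    omega

lemma measurableSet_alive (n : ℕ) : MeasurableSet {ω : Config quadrantEdges | Alive ω n} := by
  have : {ω : Config quadrantEdges | Alive ω n} = ⋃ a, ⋃ (_ : a ≤ n), {ω | Reached ω a (n - a)} := by
    ext ω; simp [Alive]
  rw [this]
  exact MeasurableSet.iUnion fun a => MeasurableSet.iUnion fun _ =>
    coordAlg_le _ _ (measurableSet_reached a (n - a))

lemma measurableSet_infinite :
    MeasurableSet {ω : Config quadrantEdges | (cluster quadrantEdges ω (0, 0)).Infinite} := by
  have : {ω : Config quadrantEdges | (cluster quadrantEdges ω (0, 0)).Infinite} =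
      ⋂ n, {ω | Alive ω n} := by
    ext ω; simp only [Set.mem_ofPred_eq, infinite_iff_alive, Set.mem_iInter]
  rw [this]
  exact MeasurableSet.iInter measurableSet_alive

/-! ### Survival at `p = 2 / 3` -/

open Classical in
/-- The occupied sites of level `n`. -/
noncomputable def row (n : ℕ) (ω : Config quadrantEdges) : Fin (n + 1) → Bool :=
  fun i => decide (Reached ω i (n - i))

lemma measurableSet_row (n : ℕ) (B : Fin (n + 1) → Bool) :
    MeasurableSet[coordAlg (edgesBelow n)] {ω | row n ω = B} := by
  have : {ω | row n ω = B} = ⋂ i, {ω | row n ω i = B i} := by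
    ext ω; simp [funext_iff]
  rw [this]
  refine @MeasurableSet.iInter _ _ (coordAlg _) _ _ fun i => ?_
  have h := measurableSet_reached i (n - i)
  rw [show (i : ℕ) + (n - i) = n by have := i.2; omega] at h
  cases hb : B i
  · have e : {ω | row n ω i = false} = {ω | Reached ω i (n - i)}ᶜ := by ext; simp [row]
    rw [e]
    exact @MeasurableSet.compl _ _ (coordAlg _) h
  · have e : {ω | row n ω i = true} = {ω | Reached ω i (n - i)} := by ext; simp [row]
    rw [e]
    exact h

/-- The edges into the site `x` of level `n + 1` from the sites marked by `l`. -/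
def parentEdges (n : ℕ) (l : List Bool) (x : ℕ) : Finset quadrantEdges :=
  (if (false :: l).getD x false then {rightEdge (x - 1) (n + 1 - x)} else ∅) ∪
    if l.getD x false then {upEdge x (n - x)} else ∅

lemma card_parentEdges (n : ℕ) (l : List Bool) (x : ℕ) : (parentEdges n l x).card =
    ((false :: l).getD x false).toNat + (l.getD x false).toNat := by
  have hne : rightEdge (x - 1) (n + 1 - x) ≠ upEdge x (n - x) := by
    intro h
    have h1 := congrArg (fun e : quadrantEdges => e.1.1.1 + e.1.2.1) h
    have h2 := congrArg (fun e : quadrantEdges => e.1.1.1) h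
    simp only [rightEdge, upEdge] at h1 h2
    omega
  unfold parentEdges
  cases (false :: l).getD x false <;> cases l.getD x false <;> simp [Finset.card_insert_of_notMem, hne]

lemma parentEdges_subset {n : ℕ} {l : List Bool} (hl : l.length = n + 1) (x : ℕ) :
    (parentEdges n l x : Set quadrantEdges) ⊆ {e | e.1.2 = (x, n + 1 - x)} := by
  intro e he
  rcases Finset.mem_union.mp (Finset.mem_coe.mp he) with he | he
  · split_ifs at he with h
    · rw [Finset.mem_singleton] at he
      subst he
      cases x with
      | zero => simp at h
      | succ x => rfl
    · simp at he
  · split_ifs at he with h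
    · rw [Finset.mem_singleton] at he
      subst he
      have hx : x < n + 1 := by
        by_contra hx
        rw [List.getD_eq_default _ _ (by omega)] at h
        simp at h
      change (x, n - x + 1) = (x, n + 1 - x)
      congr 1
      omega
    · simp at he

lemma row_getD (n : ℕ) (ω : Config quadrantEdges) (x : ℕ) :
    (List.ofFn (row n ω)).getD x false = true ↔ x ≤ n ∧ Reached ω x (n - x) := by
  by_cases hx : x < n + 1
  · rw [List.getD_eq_getElem _ _ (by simpa using hx), List.getElem_ofFn]
    simp [row, Nat.lt_succ_iff.mp hx]
  · rw [List.getD_eq_default _ _ (by simp; omega)]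
    simp
    omega

lemma reached_succ_iff (n : ℕ) (ω : Config quadrantEdges) {x : ℕ} (hx : x ≤ n + 1) :
    Reached ω x (n + 1 - x) ↔
      ∃ e ∈ parentEdges n (List.ofFn (row n ω)) x, ω e = true := by
  have h1 := row_getD n ω x
  have h2 : (false :: List.ofFn (row n ω)).getD x false = true ↔
      ∃ a', x = a' + 1 ∧ Reached ω a' (n + 1 - x) := by
    cases x with
    | zero => simp
    | succ x =>
      rw [List.getD_cons_succ, row_getD]
      have : n + 1 - (x + 1) = n - x := by omega
      rw [this]
      constructor
      · rintro ⟨-, h⟩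
        exact ⟨x, rfl, h⟩
      · rintro ⟨a', h, h'⟩
        obtain rfl : x = a' := by omega
        exact ⟨by omega, h'⟩
  rw [reached_iff]
  unfold parentEdges
  constructor
  · rintro (h | ⟨a', rfl, h3, h4⟩ | ⟨b', hb, h3, h4⟩)
    · omega
    · exact ⟨_, Finset.mem_union_left _ (by
        rw [if_pos (h2.mpr ⟨a', rfl, h3⟩)]; exact Finset.mem_singleton_self _), h4⟩
    · obtain rfl : b' = n - x := by omega
      exact ⟨_, Finset.mem_union_right _ (by
        rw [if_pos (h1.mpr ⟨by omega, h3⟩)]; exact Finset.mem_singleton_self _), h4⟩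
  · rintro ⟨e, he, h4⟩
    rcases Finset.mem_union.mp he with he | he
    · split_ifs at he with h
      · obtain ⟨a', rfl, h3⟩ := h2.mp h
        rw [Finset.mem_singleton] at he
        subst he
        exact Or.inr (Or.inl ⟨a', rfl, h3, h4⟩)
      · simp at he
    · split_ifs at he with h
      · obtain ⟨h5, h3⟩ := h1.mp h
        rw [Finset.mem_singleton] at he
        subst he
        exact Or.inr (Or.inr ⟨n - x, by omega, h3, h4⟩)
      · simp at he

/-- The parameter `2 / 3`. -/
noncomputable def twoThirds : unitInterval := ⟨2 / 3, by norm_num, by norm_num⟩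

lemma real_exists_parent (n : ℕ) (l : List Bool) (x : ℕ) (b : Bool) :
    (coins quadrantEdges twoThirds).real
        {ω | (∃ e ∈ parentEdges n l x, ω e = true) ↔ b = true} =
      markProb (siteWeight ((false :: l).getD x false) (l.getD x false)) b := by
  have hp : 1 - (twoThirds : ℝ) = 1 / 3 := by norm_num [twoThirds]
  rw [siteWeight, ← card_parentEdges n l x, ← hp, markProb]
  cases b with
  | true => simp only [iff_true, if_true]; exact coins_exists_open _ _
  | false =>
    simp only [Bool.false_eq_true, iff_false, if_false, not_exists, not_and, Bool.not_eq_true]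
    exact coins_forall_closed _ _

/-- Given level n, each site of level n + 1 looks only at its own incoming edges from occupied
parents. These edge sets are disjoint for different sites and disjoint from the edges that determine
level n. -/
lemma real_row_row (n : ℕ) (B : Fin (n + 1) → Bool) (B' : Fin (n + 2) → Bool) :
    (coins quadrantEdges twoThirds).real ({ω | row (n + 1) ω = B'} ∩ {ω | row n ω = B}) =
      (coins quadrantEdges twoThirds).real {ω | row n ω = B} *
        ∏ i : Fin (n + 2), markProb (siteWeight ((false :: List.ofFn B).getD i false)
          ((List.ofFn B).getD i false)) (B' i) := by
  have hsub := fun x => parentEdges_subset (n := n) (l := List.ofFn B) (by simp) x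
  have e : {ω | row (n + 1) ω = B'} ∩ {ω | row n ω = B} = {ω | row n ω = B} ∩
      ⋂ i ∈ (Finset.univ : Finset (Fin (n + 2))),
        {ω | (∃ e ∈ parentEdges n (List.ofFn B) i, ω e = true) ↔ B' i = true} := by
    ext ω
    rw [Set.inter_comm]
    simp only [Set.mem_inter_iff, Set.mem_ofPred_eq, Finset.mem_univ, Set.iInter_true,
      Set.mem_iInter, and_congr_right_iff]
    rintro rfl
    rw [funext_iff]
    refine forall_congr' fun i => ?_
    rw [← reached_succ_iff n ω (by have := i.2; omega), Bool.eq_iff_iff]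
    simp [row]
  have hmeas : ∀ i ∈ (Finset.univ : Finset (Fin (n + 2))),
      MeasurableSet[coordAlg (parentEdges n (List.ofFn B) i : Set quadrantEdges)]
        {ω | (∃ e ∈ parentEdges n (List.ofFn B) i, ω e = true) ↔ B' i = true} := by
    intro i _
    have h := measurableSet_exists_open (parentEdges n (List.ofFn B) i)
    cases B' i with
    | true => simpa using h
    | false =>
      have := @MeasurableSet.compl _ _ (coordAlg _) h
      convert this using 1
      ext ω; simp
  have hdisj : ∀ i ∈ (Finset.univ : Finset (Fin (n + 2))), ∀ j ∈ Finset.univ, i ≠ j →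
      Disjoint (parentEdges n (List.ofFn B) i : Set quadrantEdges)
        (parentEdges n (List.ofFn B) j) := by
    intro i _ j _ hij
    refine Set.disjoint_left.mpr fun e h1 h2 => hij (Fin.ext ?_)
    exact congrArg Prod.fst ((hsub i h1).symm.trans (hsub j h2))
  obtain ⟨h1, h2⟩ := coins_biInter twoThirds _ _ _ hdisj hmeas
  rw [e, coins_inter twoThirds ?_ (measurableSet_row n B) h1, h2]
  · simp only [real_exists_parent]
  · refine Set.disjoint_iUnion₂_right.mpr fun i _ => Set.disjoint_left.mpr fun e h3 h4 => ?_
    have h5 : e.1.2 = ((i : ℕ), n + 1 - i) := hsub i h4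
    have h6 : e.1.1.1 + e.1.1.2 < n := h3
    have h7 := i.2
    rcases e.2 with h8 | h8 <;> rw [h8] at h5 <;> simp only [Prod.mk.injEq] at h5 <;> omega

lemma sum_real_inter_row (n : ℕ) (A : Set (Config quadrantEdges)) (hA : MeasurableSet A) :
    (coins quadrantEdges twoThirds).real A =
      ∑ B, (coins quadrantEdges twoThirds).real (A ∩ {ω | row n ω = B}) := by
  rw [← measureReal_biUnion_finset]
  · congr 1; ext ω; simp
  · intro v _ w _ hvw
    refine Set.disjoint_left.mpr ?_
    rintro ω ⟨-, h1⟩ ⟨-, h2⟩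
    exact hvw (h1.symm.trans h2)
  · exact fun v _ => hA.inter (coordAlg_le _ _ (measurableSet_row n v))

/-- The supermartingale bound: it starts at 1/2 for the single occupied origin, and
`expect_evolved_le` controls each step conditionally on the current level. -/
lemma sum_row_avoid_le (n : ℕ) :
    ∑ B, (coins quadrantEdges twoThirds).real {ω | row n ω = B} * expect (avoid (List.ofFn B)) ≤
      1 / 2 := by
  induction n with
  | zero =>
    have h : ∀ ω, row 0 ω = fun _ => true := fun ω => by
      funext i
      obtain rfl : i = 0 := Fin.ext (by have := i.2; omega)
      simp only [row, decide_eq_true_iff]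
      exact (reached_iff ω 0 0).mpr (Or.inl ⟨rfl, rfl⟩)
    rw [Finset.sum_eq_single (fun _ => true)]
    · simp only [h, Set.ofPred_true, probReal_univ, one_mul]
      exact expect_avoid_true.le
    · intro B _ hB
      have : {ω | row 0 ω = B} = ∅ :=
        Set.eq_empty_of_forall_notMem fun ω hω => hB (Eq.trans (Eq.symm hω) (h ω))
      rw [this, measureReal_empty, zero_mul]
    · simp
  | succ n ih =>
    refine le_trans ?_ ih
    have e : ∀ B' : Fin (n + 2) → Bool,
        (coins quadrantEdges twoThirds).real {ω | row (n + 1) ω = B'} *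
          expect (avoid (List.ofFn B')) =
        ∑ B, (coins quadrantEdges twoThirds).real {ω | row n ω = B} *
          expect ((∏ i : Fin (n + 2), markProb (siteWeight ((false :: List.ofFn B).getD i false)
            ((List.ofFn B).getD i false)) (B' i)) • avoid (List.ofFn B')) := by
      intro B'
      rw [sum_real_inter_row n _ (coordAlg_le _ _ (measurableSet_row (n + 1) B')), Finset.sum_mul]
      refine Finset.sum_congr rfl fun B _ => ?_
      rw [real_row_row, map_smul, smul_eq_mul, mul_assoc]
    rw [Finset.sum_congr rfl fun B' _ => e B', Finset.sum_comm]
    refine Finset.sum_le_sum fun B _ => ?_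
    rw [← Finset.mul_sum, ← map_sum]
    refine mul_le_mul_of_nonneg_left ?_ measureReal_nonneg
    refine le_of_eq_of_le ?_ (expect_evolved_le (List.ofFn B))
    rw [sum_avoid (n + 2) (fun i => siteWeight ((false :: List.ofFn B).getD i false)
      ((List.ofFn B).getD i false)), evolved_eq_opWord, List.length_ofFn]

/-- The empty row has avoidance probability 1 and all other rows contribute nonnegatively, so the
probability of the empty row is at most the bounded average. -/
lemma half_le_alive (n : ℕ) :
    1 / 2 ≤ (coins quadrantEdges twoThirds).real {ω | Alive ω n} := by
  have h1 : (coins quadrantEdges twoThirds).real {ω | row n ω = fun _ => false} ≤ 1 / 2 := by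
    refine le_trans ?_ (sum_row_avoid_le n)
    refine le_trans (le_of_eq ?_) (Finset.single_le_sum (f := fun B =>
      (coins quadrantEdges twoThirds).real {ω | row n ω = B} * expect (avoid (List.ofFn B)))
      (fun B _ => mul_nonneg measureReal_nonneg (expect_avoid_nonneg _))
      (Finset.mem_univ fun _ => false))
    rw [expect_avoid_false _ (by simp), mul_one]
  have h2 : {ω : Config quadrantEdges | row n ω = fun _ => false} = {ω | Alive ω n}ᶜ := by
    ext ω
    simp only [Set.mem_ofPred_eq, Set.mem_compl_iff, Alive, not_exists, not_and, funext_iff, row,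
      decide_eq_false_iff_not]
    exact ⟨fun h a ha => h ⟨a, by omega⟩, fun h i => h i (by have := i.2; omega)⟩
  rw [h2, probReal_compl_eq_one_sub (measurableSet_alive n)] at h1
  linarith

lemma half_le_infinite : 1 / 2 ≤ (law quadrantEdges twoThirds).real
    {ω | (cluster quadrantEdges ω (0, 0)).Infinite} := by
  change 1 / 2 ≤ (coins quadrantEdges twoThirds).real _
  have e : {ω : Config quadrantEdges | (cluster quadrantEdges ω (0, 0)).Infinite} =
      ⋂ n, {ω | Alive ω n} := by
    ext ω; simp only [Set.mem_ofPred_eq, infinite_iff_alive, Set.mem_iInter]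
  have ht := tendsto_measure_iInter_atTop (μ := coins quadrantEdges twoThirds)
    (s := fun n => {ω | Alive ω n}) (fun n => (measurableSet_alive n).nullMeasurableSet)
    (fun m n hmn ω h => Alive.anti hmn h) ⟨0, measure_ne_top _ _⟩
  rw [e]
  exact ge_of_tendsto' ((ENNReal.tendsto_toReal (measure_ne_top _ _)).comp ht) half_le_alive

/-- Liggett's upper bound for the critical parameter of oriented bond percolation. -/
theorem pcOriented_le : pcOriented ≤ 2 / 3 := by
  refine csInf_le ⟨0, fun p hp => hp.2.1.le⟩ ⟨twoThirds.2, by norm_num, ?_⟩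
  exact lt_of_lt_of_le (by norm_num) half_le_infinite

/-! ### Embedding the quadrant into the example by blocks -/

section Blocks

variable {M m : ℕ}

/-- The `v`-th vertex of the block of `ℤ²` that stands for the vertex `x` of the quadrant. -/
def site (m : ℕ) (x : ℕ × ℕ) (v : Fin (m + 1)) : Fin 2 → ℤ :=
  ![(x.1 : ℤ) * (m + 1) + v, (x.1 : ℤ) + x.2]

lemma site_injective {x y : ℕ × ℕ} {v w : Fin (m + 1)} (h : site m x v = site m y w) :
    x = y ∧ v = w := by
  have h0 : (x.1 : ℤ) * (m + 1) + v = (y.1 : ℤ) * (m + 1) + w := by simpa [site] using congrFun h 0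
  have h1 : (x.1 : ℤ) + x.2 = (y.1 : ℤ) + y.2 := by simpa [site] using congrFun h 1
  have hn : x.1 * (m + 1) + v = y.1 * (m + 1) + w := by exact_mod_cast h0
  have e1 : x.1 = y.1 := by
    have := congrArg (· / (m + 1)) hn
    simpa [Nat.add_div_of_dvd_right, Nat.mul_add_div, mul_comm _ (m + 1),
      Nat.div_eq_of_lt v.2, Nat.div_eq_of_lt w.2] using this
  rw [e1] at hn h1
  exact ⟨Prod.ext e1 (by omega), Fin.ext (by omega)⟩

/-- The edge of `ℤ²` from the `v`-th vertex of the source block of `f` to the `w`-th vertex of its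
target block. -/
def cellEdge (hM : 2 * (m + 1) ≤ M + 1) (f : quadrantEdges) (v w : Fin (m + 1)) :
    latticeEdges (exampleDir M) :=
  ⟨(site m f.1.1 v, site m f.1.2 w), by
    refine Or.inr ⟨((f.1.2.1 : ℤ) - f.1.1.1) * (m + 1) + w - v, ?_, ?_⟩
    · have hv := v.2
      have hw := w.2
      -- The horizontal displacement lies between -m and 2m + 1, and 2m + 1 ≤ M.
      rcases f.2 with h | h <;> rw [h, abs_le] <;> push_cast <;> constructor <;> ring_nf <;> omega
    · funext i
      fin_cases i
      · simp [site]; ring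
      · rcases f.2 with h | h <;> simp [site, h]⟩

lemma cellEdge_injective {hM : 2 * (m + 1) ≤ M + 1} {f g : quadrantEdges} {v w v' w' : Fin (m + 1)}
    (h : cellEdge hM f v w = cellEdge hM g v' w') : f = g ∧ w = w' := by
  have h1 := congrArg (fun e : latticeEdges (exampleDir M) => e.1.1) h
  have h2 := congrArg (fun e : latticeEdges (exampleDir M) => e.1.2) h
  obtain ⟨h3, -⟩ := site_injective h1
  obtain ⟨h4, h5⟩ := site_injective h2
  exact ⟨Subtype.ext (Prod.ext h3 h4), h5⟩

/-- The edges from the `v`-th vertex of the source block of `f` to the target block. -/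
def cell (hM : 2 * (m + 1) ≤ M + 1) (f : quadrantEdges) (v : Fin (m + 1)) :
    Finset (latticeEdges (exampleDir M)) :=
  Finset.univ.map ⟨cellEdge hM f v, fun _ _ h => (cellEdge_injective h).2⟩

lemma mem_cell {hM : 2 * (m + 1) ≤ M + 1} {f : quadrantEdges} {v : Fin (m + 1)}
    {e : latticeEdges (exampleDir M)} : e ∈ cell hM f v ↔ ∃ w, cellEdge hM f v w = e := by
  simp only [cell, Finset.mem_map, Finset.mem_univ, true_and]
  rfl

/-- The edges of `ℤ²` whose source has height less than `n`. -/
def latticeEdgesBelow (M n : ℕ) : Set (latticeEdges (exampleDir M)) := {e | e.1.1 1 < n}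

/-- The vertices of the blocks reached from the origin through the cells. -/
def SiteReached (hM : 2 * (m + 1) ≤ M + 1) (ω : Config (latticeEdges (exampleDir M)))
    (x : ℕ × ℕ) (v : Fin (m + 1)) : Prop :=
  Relation.ReflTransGen (fun s t : (ℕ × ℕ) × Fin (m + 1) =>
    ∃ f : quadrantEdges, f.1 = (s.1, t.1) ∧ ω (cellEdge hM f s.2 t.2) = true) ((0, 0), 0) (x, v)

variable {hM : 2 * (m + 1) ≤ M + 1} {ω : Config (latticeEdges (exampleDir M))}

lemma SiteReached.step {f : quadrantEdges} {v w : Fin (m + 1)} (h : SiteReached hM ω f.1.1 v)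
    (hf : ω (cellEdge hM f v w) = true) : SiteReached hM ω f.1.2 w :=
  Relation.ReflTransGen.tail h ⟨f, rfl, hf⟩

lemma siteReached_iff (x : ℕ × ℕ) (w : Fin (m + 1)) : SiteReached hM ω x w ↔
    (x = (0, 0) ∧ w = 0) ∨ ∃ f : quadrantEdges, f.1.2 = x ∧ ∃ v, SiteReached hM ω f.1.1 v ∧
      ω (cellEdge hM f v w) = true := by
  constructor
  · intro h
    rcases Relation.ReflTransGen.cases_tail h with h | ⟨⟨y, v⟩, h1, f, h2, h3⟩
    · left; simpa using h
    · refine Or.inr ⟨f, by rw [h2], v, ?_, h3⟩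
      rw [h2]
      exact h1
  · rintro (⟨rfl, rfl⟩ | ⟨f, rfl, v, h1, h2⟩)
    · exact Relation.ReflTransGen.refl
    · exact h1.step h2

lemma SiteReached.mem_cluster {x : ℕ × ℕ} {v : Fin (m + 1)} (h : SiteReached hM ω x v) :
    site m x v ∈ cluster (latticeEdges (exampleDir M)) ω 0 := by
  have h0 : site m (0, 0) 0 = 0 := by
    funext i; fin_cases i <;> simp [site]
  rw [← h0]
  refine Relation.ReflTransGen.lift (fun s : (ℕ × ℕ) × Fin (m + 1) => site m s.1 s.2) ?_ _ _ h
  rintro ⟨x, v⟩ ⟨y, w⟩ ⟨f, hf, hω⟩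
  obtain ⟨rfl, rfl⟩ : f.1.1 = x ∧ f.1.2 = y := by rw [hf]; exact ⟨rfl, rfl⟩
  exact ⟨(cellEdge hM f v w).2, hω⟩

lemma level_succ (f : quadrantEdges) : f.1.2.1 + f.1.2.2 = f.1.1.1 + f.1.1.2 + 1 := by
  rcases f.2 with h | h <;> rw [h] <;> simp only <;> omega

lemma measurableSet_siteReached (hM : 2 * (m + 1) ≤ M + 1) (x : ℕ × ℕ) (w : Fin (m + 1)) :
    MeasurableSet[coordAlg (latticeEdgesBelow M (x.1 + x.2))] {ω | SiteReached hM ω x w} := by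
  induction hn : x.1 + x.2 using Nat.strong_induction_on generalizing x w with
  | _ n ih =>
    have e : {ω | SiteReached hM ω x w} = {ω | x = (0, 0) ∧ w = 0} ∪ ⋃ f : quadrantEdges, ⋃ v,
        {ω | f.1.2 = x ∧ SiteReached hM ω f.1.1 v ∧ ω (cellEdge hM f v w) = true} := by
      ext ω
      simp only [Set.mem_ofPred_eq, siteReached_iff x w, Set.mem_union, Set.mem_iUnion]
      refine or_congr_right ⟨?_, ?_⟩
      · rintro ⟨f, h1, v, h2, h3⟩; exact ⟨f, v, h1, h2, h3⟩
      · rintro ⟨f, v, h1, h2, h3⟩; exact ⟨f, h1, v, h2, h3⟩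
    rw [e]
    refine @MeasurableSet.union _ (coordAlg _) _ _ (@MeasurableSet.const _ (coordAlg _) _)
      (@MeasurableSet.iUnion _ _ (coordAlg _) _ _ fun f =>
        @MeasurableSet.iUnion _ _ (coordAlg _) _ _ fun v => ?_)
    by_cases h : f.1.2 = x
    · simp only [h, true_and]
      have hl := level_succ f
      rw [h, hn] at hl
      refine @MeasurableSet.inter _ (coordAlg _) _ _ (coordAlg_mono ?_ _
        (ih (f.1.1.1 + f.1.1.2) (by omega) f.1.1 v rfl)) (measurableSet_coord ?_ true)
      · intro e (he : e.1.1 1 < ((f.1.1.1 + f.1.1.2 : ℕ) : ℤ))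
        change e.1.1 1 < (n : ℤ)
        omega
      · change site m f.1.1 v 1 < (n : ℤ)
        simp only [site, Matrix.cons_val_one, Matrix.cons_val_fin_one]
        omega
    · simp only [h, false_and]
      exact @MeasurableSet.empty _ (coordAlg _)

open Classical in
/-- A fixed selection of an element of a nonempty set. -/
noncomputable def select (s : Set (Fin (m + 1))) : Fin (m + 1) :=
  if h : s.Nonempty then h.some else 0

/-- The selected reached vertex of the source block of `f`. -/
noncomputable def source (hM : 2 * (m + 1) ≤ M + 1) (f : quadrantEdges)
    (ω : Config (latticeEdges (exampleDir M))) : Fin (m + 1) :=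
  select {v | SiteReached hM ω f.1.1 v}

lemma siteReached_source {f : quadrantEdges} (h : ∃ v, SiteReached hM ω f.1.1 v) :
    SiteReached hM ω f.1.1 (source hM f ω) := by
  have h' : {v | SiteReached hM ω f.1.1 v}.Nonempty := h
  unfold source select
  rw [dif_pos h']
  exact h'.some_mem

/-- The selection is a function of the set of reached sites of the block alone; there are finitely
many such sets, each determined by the edges below that level. -/
lemma measurableSet_source (hM : 2 * (m + 1) ≤ M + 1) (f : quadrantEdges) (v : Fin (m + 1)) :
    MeasurableSet[coordAlg (latticeEdgesBelow M (f.1.1.1 + f.1.1.2))] {ω | source hM f ω = v} := by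
  classical
  have e : {ω | source hM f ω = v} = ⋃ s : Set (Fin (m + 1)),
      {ω | select s = v} ∩ ⋂ w, {ω | SiteReached hM ω f.1.1 w ↔ w ∈ s} := by
    ext ω
    simp only [Set.mem_ofPred_eq, Set.mem_iUnion, Set.mem_inter_iff, Set.mem_iInter]
    constructor
    · intro h
      exact ⟨{w | SiteReached hM ω f.1.1 w}, h, fun w => Iff.rfl⟩
    · rintro ⟨s, h1, h2⟩
      have : {w | SiteReached hM ω f.1.1 w} = s := Set.ext h2
      rw [source, this, h1]
  rw [e]
  refine @MeasurableSet.iUnion _ _ (coordAlg _) _ _ fun s => @MeasurableSet.inter _ (coordAlg _) _ _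
    (@MeasurableSet.const _ (coordAlg _) _) (@MeasurableSet.iInter _ _ (coordAlg _) _ _ fun w => ?_)
  have h := measurableSet_siteReached hM f.1.1 w
  by_cases hw : w ∈ s
  · simpa only [hw, iff_true] using h
  · simp only [hw, iff_false]
    exact @MeasurableSet.compl _ _ (coordAlg _) h

open Classical in
/-- The configuration on the quadrant read off the cells issued from the selected vertices. -/
noncomputable def blockConfig (hM : 2 * (m + 1) ≤ M + 1)
    (ω : Config (latticeEdges (exampleDir M))) : Config quadrantEdges :=
  fun f => decide (∃ e ∈ cell hM f (source hM f ω), ω e = true)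

/-- An instance of `map_adapted_coins`: the source is chosen from strictly lower rows, while the
edges of its cell leave the source's own row. -/
lemma map_blockConfig (hM : 2 * (m + 1) ≤ M + 1) (p q : unitInterval)
    (hpq : 1 - (1 - (p : ℝ)) ^ (m + 1) = q) :
    Measurable (blockConfig hM) ∧ (law (latticeEdges (exampleDir M)) p).map (blockConfig hM) =
      law quadrantEdges q := by
  refine map_adapted_coins p q (fun f : quadrantEdges => f.1.1.1 + f.1.1.2) (latticeEdgesBelow M)
    ?_ (cell hM) (source hM) (measurableSet_source hM) ?_ ?_ ?_ (blockConfig hM) ?_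
  · intro a b hab e (he : e.1.1 1 < (a : ℤ))
    change e.1.1 1 < (b : ℤ)
    omega
  · refine fun f v => Set.disjoint_left.mpr fun e h1 h2 => ?_
    obtain ⟨w, rfl⟩ := mem_cell.mp h2
    have h3 : site m f.1.1 v 1 < ((f.1.1.1 + f.1.1.2 : ℕ) : ℤ) := h1
    simp [site] at h3
  · refine fun f g hfg v v' => Set.disjoint_left.mpr fun e h1 h2 => hfg ?_
    obtain ⟨w, rfl⟩ := mem_cell.mp h1
    obtain ⟨w', h⟩ := mem_cell.mp h2
    exact (cellEdge_injective h.symm).1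
  · intro f v
    simpa [cell] using hpq
  · intro ω f
    simp [blockConfig]

/-- The default selection in unreached blocks keeps the coins identically distributed but is never
used here: along an open path from the origin, each source block has already been reached. -/
lemma exists_siteReached_of_reached {a b : ℕ} (h : Reached (blockConfig hM ω) a b) :
    ∃ v, SiteReached hM ω (a, b) v := by
  have key : ∀ x, x ∈ cluster quadrantEdges (blockConfig hM ω) (0, 0) →
      ∃ v, SiteReached hM ω x v := by
    intro x hx
    induction hx with
    | refl => exact ⟨0, Relation.ReflTransGen.refl⟩
    | @tail y z _ hyz ih =>
      obtain ⟨hE, ho⟩ := hyz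
      have h1 := siteReached_source (f := ⟨(y, z), hE⟩) ih
      simp only [blockConfig, decide_eq_true_iff] at ho
      obtain ⟨e, he, heo⟩ := ho
      obtain ⟨w, rfl⟩ := mem_cell.mp he
      exact ⟨w, h1.step heo⟩
  exact key _ h

lemma extension_eq_top_of_infinite
    (h : (cluster quadrantEdges (blockConfig hM ω) (0, 0)).Infinite) :
    extension (exampleDir M) e₂ ω 0 = ⊤ := by
  rw [infinite_iff_alive] at h
  refine EReal.eq_top_iff_forall_lt _ |>.mpr fun r => ?_
  obtain ⟨n, hn⟩ := exists_nat_gt r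
  obtain ⟨a, ha, hr⟩ := h n
  obtain ⟨v, hv⟩ := exists_siteReached_of_reached hr
  refine lt_of_lt_of_le (EReal.coe_lt_coe_iff.mpr hn) ?_
  refine le_trans (le_of_eq ?_) (le_iSup₂ (f := fun y
    (_ : y ∈ cluster (latticeEdges (exampleDir M)) ω 0) =>
      ((∑ i, ((y i : ℝ) - ((0 : Fin 2 → ℤ) i : ℝ)) * e₂ i : ℝ) : EReal)) _ hv.mem_cluster)
  have : ((a : ℝ) + (n - a : ℕ)) = n := by
    rw [← Nat.cast_add]; congr 1; omega
  simp [site, e₂, Fin.sum_univ_two, this]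

/-- If `q` percolates on the quadrant, then a parameter `p` for which one of `m + 1` edges is open
with probability `q` percolates upwards on the lattice. -/
theorem pc_le_of_percolates (hM : 2 * (m + 1) ≤ M + 1) (p q : unitInterval) (hp : 0 < (p : ℝ))
    (hpq : 1 - (1 - (p : ℝ)) ^ (m + 1) = q)
    (hq : 0 < (law quadrantEdges q).real {ω | (cluster quadrantEdges ω (0, 0)).Infinite}) :
    pc (exampleDir M) e₂ ≤ p := by
  refine csInf_le ⟨0, fun p hp => hp.2.1.le⟩ ⟨p.2, hp, ?_⟩
  obtain ⟨h1, h2⟩ := map_blockConfig hM p q hpq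
  rw [← h2, map_measureReal_apply h1 measurableSet_infinite] at hq
  have : IsProbabilityMeasure (law (latticeEdges (exampleDir M)) p) :=
    inferInstanceAs (IsProbabilityMeasure (coins _ p))
  exact lt_of_lt_of_le hq (measureReal_mono fun ω hω => extension_eq_top_of_infinite hω)

end Blocks

/-! ### Exponentially weighted path counting -/

section FirstMoment

variable {V ι : Type*}

/-- The edges of the walk from `x` with the given steps. -/
def walkEdges (step : ι → V → V) : V → List ι → List (V × V)
  | _, [] => []
  | x, i :: l => (x, step i x) :: walkEdges step (step i x) l

/-- The end of the walk from `x` with the given steps. -/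
def walkEnd (step : ι → V → V) : V → List ι → V
  | x, [] => x
  | x, i :: l => walkEnd step (step i x) l

variable {step : ι → V → V}

lemma length_walkEdges (x : V) (l : List ι) : (walkEdges step x l).length = l.length := by
  induction l generalizing x with
  | nil => rfl
  | cons i l ih => simp [walkEdges, ih]

lemma exists_suffix_walk (x y : V) (l : List ι) (h : x ∈ (walkEdges step y l).map Prod.fst) :
    ∃ l', walkEdges step x l' <:+ walkEdges step y l ∧ walkEnd step x l' = walkEnd step y l := by
  induction l generalizing y with
  | nil => simp [walkEdges] at h
  | cons i l ih =>
    rw [walkEdges, List.map_cons, List.mem_cons] at h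
    rcases h with rfl | h
    · exact ⟨i :: l, List.suffix_refl _, rfl⟩
    · obtain ⟨l', h1, h2⟩ := ih _ h
      exact ⟨l', h1.trans (List.suffix_cons _ _), h2⟩

/-- Prepend the edges one at a time; if the new vertex is already a source, keep only the suffix
that starts there. -/
lemma exists_simple_walk {E : Set (V × V)} (hE : ∀ e ∈ E, ∃ i, e.2 = step i e.1) (ω : Config E)
    {x y : V} (h : y ∈ cluster E ω x) :
    ∃ l, walkEnd step x l = y ∧ (∀ e ∈ walkEdges step x l, OpenEdge E ω e.1 e.2) ∧
      ((walkEdges step x l).map Prod.fst).Nodup := by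
  induction h using Relation.ReflTransGen.head_induction_on with
  | refl => exact ⟨[], rfl, by simp [walkEdges], by simp [walkEdges]⟩
  | @head a c hac _ ih =>
    obtain ⟨l, h1, h2, h3⟩ := ih
    by_cases ha : a ∈ (walkEdges step c l).map Prod.fst
    · obtain ⟨l', h4, h5⟩ := exists_suffix_walk a c l ha
      exact ⟨l', h5.trans h1, fun e he => h2 e (h4.subset he), h3.sublist (h4.sublist.map _)⟩
    · obtain ⟨i, hi⟩ := hE (a, c) hac.1
      simp only at hi
      subst hi
      refine ⟨i :: l, h1, ?_, ?_⟩
      · intro e he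
        rcases List.mem_cons.mp he with rfl | he
        · exact hac
        · exact h2 e he
      · rw [walkEdges, List.map_cons]
        exact List.nodup_cons.mpr ⟨ha, h3⟩

/-- Distinct sources force distinct edges, so the walk uses as many independent coins as it has
steps. Walks outside the graph or with a repeated source give the empty event. -/
lemma law_walk_open_le {E : Set (V × V)} (p : unitInterval) (x : V) (l : List ι) :
    law E p {ω | (∀ e ∈ walkEdges step x l, OpenEdge E ω e.1 e.2) ∧
      ((walkEdges step x l).map Prod.fst).Nodup} ≤ ENNReal.ofReal ((p : ℝ) ^ l.length) := by
  classical
  by_cases h : (∀ e ∈ walkEdges step x l, e ∈ E) ∧ ((walkEdges step x l).map Prod.fst).Nodup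
  · obtain ⟨h1, h2⟩ := h
    set K : Finset E := (walkEdges step x l).toFinset.subtype (· ∈ E) with hK
    have hcard : K.card = l.length := by
      rw [hK, Finset.card_subtype, Finset.filter_true_of_mem (by simpa using h1),
        List.toFinset_card_of_nodup h2.of_map, length_walkEdges]
    have h3 := coins_forall_open p K
    rw [hcard] at h3
    rw [← h3, measureReal_def, ENNReal.ofReal_toReal (measure_ne_top _ _)]
    refine measure_mono ?_
    rintro ω ⟨h4, -⟩ e he
    obtain ⟨_, h5⟩ := h4 e.1 (by simpa [hK] using he)
    exact h5
  · refine le_of_eq_of_le (measure_mono_null (t := ∅) ?_ measure_empty) zero_le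
    rintro ω ⟨h4, h5⟩
    exact h ⟨fun e he => (h4 e he).1, h5⟩

lemma height_walkEnd (h : V → ℤ) (d : ι → ℤ) (hd : ∀ i x, h (step i x) = h x + d i) (x : V)
    (l : List ι) : h (walkEnd step x l) = h x + (l.map d).sum := by
  induction l generalizing x with
  | nil => simp [walkEnd]
  | cons i l ih => rw [walkEnd, ih, hd, List.map_cons, List.sum_cons, add_assoc]

/-- If the exponential weight of the steps is less than `1`, then the cluster a.s. has bounded
height. -/
theorem law_unbounded_eq_zero [Fintype ι] {E : Set (V × V)}
    (hE : ∀ e ∈ E, ∃ i, e.2 = step i e.1) (h : V → ℤ) (d : ι → ℤ)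
    (hd : ∀ i x, h (step i x) = h x + d i) (p : unitInterval) {s : ℝ} (hs : 1 < s)
    (hr : p * ∑ i, s ^ d i < 1) (x : V) :
    law E p {ω | ∀ n : ℕ, ∃ y ∈ cluster E ω x, h x + n ≤ h y} = 0 := by
  have hs0 : 0 < s := by linarith
  set r : ℝ := p * ∑ i, s ^ d i with hrdef
  have hp0 : (0 : ℝ) ≤ p := p.2.1
  have hr0 : 0 ≤ r := mul_nonneg hp0 (Finset.sum_nonneg fun i _ => by positivity)
  have key : ∀ n : ℕ, law E p {ω | ∀ n : ℕ, ∃ y ∈ cluster E ω x, h x + n ≤ h y} ≤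
      ENNReal.ofReal ((1 - r)⁻¹ * (s⁻¹) ^ n) := by
    intro n
    let O : List ι → Set (Config E) := fun l =>
      {ω | h x + n ≤ h (walkEnd step x l) ∧ (∀ e ∈ walkEdges step x l, OpenEdge E ω e.1 e.2) ∧
        ((walkEdges step x l).map Prod.fst).Nodup}
    have hO : ∀ l, law E p (O l) ≤
        ENNReal.ofReal (s⁻¹ ^ n * ((p : ℝ) ^ l.length * s ^ (l.map d).sum)) := by
      intro l
      by_cases hl : h x + n ≤ h (walkEnd step x l)
      · refine (measure_mono fun ω hω => hω.2).trans ((law_walk_open_le p x l).trans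
          (ENNReal.ofReal_le_ofReal ?_))
        rw [height_walkEnd h d hd] at hl
        -- The Chernoff factor: a walk that gains height at least n has weight at least s^n, as s >
        -- 1.
        have h1 : (1 : ℝ) ≤ s⁻¹ ^ n * s ^ (l.map d).sum := by
          rw [inv_pow, ← zpow_natCast, ← zpow_neg, ← zpow_add₀ hs0.ne']
          exact one_le_zpow₀ hs.le (by omega)
        calc (p : ℝ) ^ l.length = (p : ℝ) ^ l.length * 1 := (mul_one _).symm
          _ ≤ (p : ℝ) ^ l.length * (s⁻¹ ^ n * s ^ (l.map d).sum) :=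
            mul_le_mul_of_nonneg_left h1 (by positivity)
          _ = _ := by ring
      · refine le_of_eq_of_le (measure_mono_null (t := ∅) ?_ measure_empty) zero_le
        exact fun ω hω => hl hω.1
    have hsub : {ω | ∀ n : ℕ, ∃ y ∈ cluster E ω x, h x + n ≤ h y} ⊆
        ⋃ k : ℕ, ⋃ f : Fin k → ι, O (List.ofFn f) := by
      intro ω hω
      obtain ⟨y, hy, hn⟩ := hω n
      obtain ⟨l, rfl, h2, h3⟩ := exists_simple_walk hE ω hy
      refine Set.mem_iUnion.mpr ⟨l.length, Set.mem_iUnion.mpr ⟨l.get, ?_⟩⟩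
      rw [List.ofFn_get]
      exact ⟨hn, h2, h3⟩
    have hk : ∀ k : ℕ, law E p (⋃ f : Fin k → ι, O (List.ofFn f)) ≤
        ENNReal.ofReal (s⁻¹ ^ n * r ^ k) := by
      intro k
      refine (measure_iUnion_fintype_le _ _).trans ((Finset.sum_le_sum fun f _ => hO _).trans ?_)
      rw [← ENNReal.ofReal_sum_of_nonneg fun f _ => by positivity]
      refine ENNReal.ofReal_le_ofReal (le_of_eq ?_)
      rw [hrdef, mul_pow, Fintype.sum_pow, Finset.mul_sum, Finset.mul_sum]
      refine Finset.sum_congr rfl fun f _ => ?_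
      rw [List.length_ofFn]
      congr 2
      rw [List.map_ofFn, List.sum_ofFn]
      have : ∀ t : Finset (Fin k), s ^ (∑ i ∈ t, d (f i)) = ∏ i ∈ t, s ^ d (f i) := by
        classical
        intro t
        induction t using Finset.induction_on with
        | empty => simp
        | insert a t ha ih => rw [Finset.sum_insert ha, Finset.prod_insert ha, zpow_add₀ hs0.ne', ih]
      exact this Finset.univ
    refine (measure_mono hsub).trans ((measure_iUnion_le _).trans
      ((ENNReal.tsum_le_tsum hk).trans (le_of_eq ?_)))
    have hg := (hasSum_geometric_of_lt_one hr0 hr).mul_left (s⁻¹ ^ n)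
    rw [← ENNReal.ofReal_tsum_of_nonneg (fun k => by positivity) hg.summable, hg.tsum_eq, mul_comm]
  have hlim : Filter.Tendsto (fun n : ℕ => ENNReal.ofReal ((1 - r)⁻¹ * (s⁻¹) ^ n)) Filter.atTop
      (nhds 0) := by
    have h1 := (tendsto_pow_atTop_nhds_zero_of_lt_one (inv_nonneg.mpr hs0.le)
      (inv_lt_one_of_one_lt₀ hs)).const_mul (1 - r)⁻¹
    rw [mul_zero] at h1
    simpa using ENNReal.tendsto_ofReal h1
  exact le_antisymm (ge_of_tendsto' hlim key) zero_le

end FirstMoment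

/-! ### Lower bounds on the critical parameters -/

/-- Oriented percolation on the quadrant does not percolate below `1 / 2`. -/
theorem half_le_pcOriented : 1 / 2 ≤ pcOriented := by
  refine le_csInf ⟨2 / 3, twoThirds.2, by norm_num, lt_of_lt_of_le (by norm_num)
    half_le_infinite⟩ ?_
  rintro p ⟨hp, hp0, hpos⟩
  by_contra hlt
  push Not at hlt
  have h0 := law_unbounded_eq_zero (E := quadrantEdges) (ι := Bool)
    (step := fun b v => if b then (v.1 + 1, v.2) else (v.1, v.2 + 1))
    (fun e he => he.elim (fun h => ⟨true, h⟩) fun h => ⟨false, h⟩)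
    (fun v => (v.1 : ℤ) + v.2) (fun _ => 1)
    -- For p < 1/2 this s exceeds 1, while 2ps = 2p/(p + 1/2) stays below 1.
    (fun i x => by cases i <;> simp <;> ring) ⟨p, hp⟩ (s := 1 / (p + 1 / 2))
    (by rw [lt_div_iff₀] <;> linarith)
    (by
      have h1 : 0 < p + 1 / 2 := by linarith
      simp only [zpow_one, Finset.sum_const, Finset.card_univ, Fintype.card_bool, nsmul_eq_mul]
      rw [mul_one_div, mul_div_assoc', div_lt_one h1]
      push_cast
      linarith) (0, 0)
  refine hpos.ne' ?_
  rw [measureReal_def, measure_mono_null ?_ h0, ENNReal.toReal_zero]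
  intro ω hω n
  obtain ⟨a, ha, hr⟩ := (infinite_iff_alive ω).mp hω n
  refine ⟨_, hr, ?_⟩
  simp only
  omega

/-- The steps of the example. -/
def exampleStep (M : ℕ) : Option (Fin (2 * M + 1)) → (Fin 2 → ℤ) → Fin 2 → ℤ
  | none, x => x + ![0, -1]
  | some k, x => x + ![(k : ℤ) - M, 1]

/-- Downwards percolation in the example requires `p ≥ 1 / (2 √(2 M + 1))`. -/
theorem le_pc_neg (M : ℕ) (hM : 1 ≤ M) :
    1 / (2 * Real.sqrt (2 * (M : ℝ) + 1)) ≤ pc (exampleDir M) (-e₂) := by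
  -- The set must be shown nonempty, since the real infimum of the empty set is 0. At p = 1 the
  -- vertical ray below the origin is open.
  refine le_csInf ⟨1, ⟨zero_le_one, le_rfl⟩, one_pos, ?_⟩ ?_
  · have hlaw : law (latticeEdges (exampleDir M)) 1 = Measure.dirac fun _ => true := by
      simp [law, Measure.infinitePi_dirac]
    change 0 < (law (latticeEdges (exampleDir M)) 1).real _
    rw [hlaw]
    have hmem : (fun _ => true) ∈ {ω : Config (latticeEdges (exampleDir M)) |
        extension (exampleDir M) (-e₂) ω 0 = ⊤} := by
      have hreach : ∀ n : ℕ, ![0, -(n : ℤ)] ∈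
          cluster (latticeEdges (exampleDir M)) (fun _ => true) 0 := by
        intro n
        induction n with
        | zero =>
          have : (![0, -((0 : ℕ) : ℤ)] : Fin 2 → ℤ) = 0 := by
            funext i; fin_cases i <;> simp
          rw [this]
          exact Relation.ReflTransGen.refl
        | succ n ih =>
          refine Relation.ReflTransGen.tail ih ⟨Or.inl ?_, rfl⟩
          funext i; fin_cases i <;> simp
      refine EReal.eq_top_iff_forall_lt _ |>.mpr fun r => ?_
      obtain ⟨n, hn⟩ := exists_nat_gt r
      refine lt_of_lt_of_le (EReal.coe_lt_coe_iff.mpr hn) ?_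
      refine le_trans (le_of_eq ?_) (le_iSup₂ (f := fun y
        (_ : y ∈ cluster (latticeEdges (exampleDir M)) (fun _ => true) 0) =>
          ((∑ i, ((y i : ℝ) - ((0 : Fin 2 → ℤ) i : ℝ)) * (-e₂) i : ℝ) : EReal)) _ (hreach n))
      simp [e₂, Fin.sum_univ_two]
    refine ENNReal.toReal_pos (fun h => ?_) (measure_ne_top _ _)
    have := Measure.le_dirac_apply (a := fun _ => true)
      (s := {ω : Config (latticeEdges (exampleDir M)) | extension (exampleDir M) (-e₂) ω 0 = ⊤})
    rw [Set.indicator_of_mem hmem, h] at this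
    simp at this
  · rintro p ⟨hp, hp0, hpos⟩
    by_contra hlt
    push Not at hlt
    -- This s minimises s + (2M + 1)/s, the total weight of one downward and 2M + 1 upward steps.
    set s := Real.sqrt (2 * (M : ℝ) + 1) with hs
    have hM' : (1 : ℝ) ≤ M := by exact_mod_cast hM
    have hs1 : 1 < s := by
      rw [hs, Real.lt_sqrt (by norm_num)]
      linarith
    have hss : s * s = 2 * M + 1 := Real.mul_self_sqrt (by linarith)
    have hE : ∀ e ∈ latticeEdges (exampleDir M), ∃ i, e.2 = exampleStep M i e.1 := by
      rintro ⟨x, y⟩ (h | ⟨k, hk, h⟩)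
      · refine ⟨none, ?_⟩
        have h' : y - x = ![0, -1] := h
        simp only [exampleStep]
        rw [← h']; abel
      · have hk' := abs_le.mp hk
        have h' : y - x = ![k, 1] := h
        refine ⟨some ⟨(k + M).toNat, by omega⟩, ?_⟩
        have : (((k + M).toNat : ℕ) : ℤ) - M = k := by omega
        simp only [exampleStep, this]
        rw [← h']; abel
    have h0 := law_unbounded_eq_zero hE (fun v => -(v 1))
      (fun i => i.elim 1 fun _ => -1) (fun i x => by cases i <;> simp [exampleStep] <;> ring)
      ⟨p, hp⟩ hs1
      (by
        rw [Fintype.sum_option]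
        simp only [Option.elim, zpow_one, Finset.sum_const, Finset.card_univ, Fintype.card_fin,
          nsmul_eq_mul, zpow_neg]
        push_cast
        rw [← hss]
        have h1 : p * (2 * s) < 1 := (lt_div_iff₀ (by linarith)).mp hlt
        have h2 : s * s * s⁻¹ = s := by field_simp
        rw [h2]
        linarith) 0
    refine hpos.ne' ?_
    rw [theta, measureReal_def, measure_mono_null ?_ h0, ENNReal.toReal_zero]
    intro ω hω n
    have h1 := (EReal.eq_top_iff_forall_lt _).mp hω n
    obtain ⟨y, h2⟩ := lt_iSup_iff.mp h1
    obtain ⟨hy, h3⟩ := lt_iSup_iff.mp h2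
    refine ⟨y, hy, ?_⟩
    have h4 := EReal.coe_lt_coe_iff.mp h3
    simp only [e₂, Fin.sum_univ_two, Pi.neg_apply, Pi.zero_apply, Int.cast_zero, sub_zero,
      Matrix.cons_val_zero, Matrix.cons_val_one, Matrix.cons_val_fin_one, neg_zero, mul_zero,
      zero_add, mul_neg, mul_one] at h4
    have h5 : (n : ℤ) < -(y 1) := by exact_mod_cast h4
    simp only [Pi.zero_apply]
    omega

/-! ### The upward bound and the numerical comparison -/

/-- The parameter at which one of `M / 2` edges is open with probability `q` percolates upwards. -/
lemma pc_e₂_le_of_percolates {M : ℕ} (hM : 1 ≤ M) (q : unitInterval) (hq0 : 0 < (q : ℝ))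
    (hq1 : (q : ℝ) < 1)
    (hq : 0 < (law quadrantEdges q).real {ω | (cluster quadrantEdges ω (0, 0)).Infinite}) :
    pc (exampleDir M) e₂ ≤ 1 - (1 - (q : ℝ)) ^ (2 / (M : ℝ)) := by
  -- Blocks have m + 1 = ⌈M/2⌉ sites: the largest width allowed by 2(m + 1) ≤ M + 1, and at least
  -- M/2 as the exponent requires.
  obtain ⟨m, hm⟩ : ∃ m, m + 1 = (M + 1) / 2 := ⟨(M + 1) / 2 - 1, by omega⟩
  have hm' : M ≤ 2 * (m + 1) := by omega
  set r : ℝ := (1 - (q : ℝ)) ^ (((m + 1 : ℕ) : ℝ)⁻¹) with hr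
  have hr0 : 0 ≤ r := Real.rpow_nonneg (by linarith) _
  have hr1 : r < 1 := Real.rpow_lt_one (by linarith) (by linarith) (by positivity)
  have hle := pc_le_of_percolates (M := M) (m := m) (by omega) ⟨1 - r, by linarith, by linarith⟩ q
    (by simpa using hr1) (by
      change 1 - (1 - (1 - r)) ^ (m + 1) = _
      rw [sub_sub_cancel, hr, Real.rpow_inv_natCast_pow (by linarith) (by omega), sub_sub_cancel])
    hq
  refine hle.trans (sub_le_sub_left ?_ 1)
  refine Real.rpow_le_rpow_of_exponent_ge (by linarith) (by linarith) ?_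
  have hM0 : (0 : ℝ) < M := by exact_mod_cast hM
  rw [inv_le_comm₀ (by positivity) (by positivity), inv_div, div_le_iff₀ two_pos, mul_comm]
  exact_mod_cast hm'

/-- Let b decrease to the critical value: below each such b lies a percolating q, and the right side
is increasing and continuous there. Neither percolation at criticality nor monotonicity of
percolation in q is needed. -/
theorem pc_e₂_le {M : ℕ} (hM : 1 ≤ M) :
    pc (exampleDir M) e₂ ≤ 1 - (1 - pcOriented) ^ (2 / (M : ℝ)) := by
  have hlt : pcOriented < 1 := pcOriented_le.trans_lt (by norm_num)
  have hcont : ContinuousAt (fun q : ℝ => 1 - (1 - q) ^ (2 / (M : ℝ))) pcOriented :=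
    continuousAt_const.sub ((continuousAt_const.sub continuousAt_id).rpow_const
      (Or.inl (by simpa using (sub_pos.mpr hlt).ne')))
  have hgt : ∀ b, pcOriented < b → b < 1 →
      pc (exampleDir M) e₂ ≤ 1 - (1 - b) ^ (2 / (M : ℝ)) := by
    intro b hb hb1
    obtain ⟨q, ⟨hq, hq0, hperc⟩, hqb⟩ := exists_lt_of_csInf_lt (by
      exact ⟨2 / 3, twoThirds.2, by norm_num, half_le_infinite.trans_lt' (by norm_num)⟩) hb
    refine (pc_e₂_le_of_percolates hM ⟨q, hq⟩ hq0 (hqb.trans hb1) hperc).trans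
      (sub_le_sub_left (Real.rpow_le_rpow (by linarith) ?_ (by positivity)) 1)
    change 1 - b ≤ 1 - q
    linarith
  refine ge_of_tendsto (hcont.tendsto.mono_left (nhdsWithin_le_nhds (s := Set.Ioi pcOriented))) ?_
  filter_upwards [Ioo_mem_nhdsGT hlt] with b hb using hgt b hb.1 hb.2

/-- For x < 2 this is the first term of the series log((1+y)/(1-y)) ≥ 2y at y = x/2; for x ≥ 2 the
right side is at least 1. -/
lemma one_sub_exp_neg_le {x : ℝ} (hx : 0 ≤ x) : 1 - Real.exp (-x) ≤ 2 * x / (2 + x) := by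
  rcases lt_or_ge x 2 with h2 | h2
  · have h := Real.sum_range_le_log_div (x := x / 2) (by linarith) (by linarith) 1
    have h3 : Real.log ((1 + x / 2) / (1 - x / 2)) ≥ x := by
      simp at h
      linarith
    have h4 := Real.exp_le_exp.mpr (neg_le_neg h3)
    rw [Real.exp_neg, Real.exp_log (div_pos (by linarith) (by linarith))] at h4
    have h5 : ((1 + x / 2) / (1 - x / 2))⁻¹ = 1 - 2 * x / (2 + x) := by
      have : (1 - x / 2) ≠ 0 := by linarith
      field_simp
      ring
    linarith
  · have h3 : 1 ≤ 2 * x / (2 + x) := by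
      rw [le_div_iff₀ (by linarith)]; linarith
    linarith [Real.exp_pos (-x)]

/-- With w = √(2M+1) and ℓ = ln 3 the claim becomes w² - 8ℓw + 2ℓ - 1 > 0, whose larger root is
about 8.65, just below √75. The cruder bound 1 - e^{-x} ≤ x would fail at M = 37. -/
lemma upper_lt_lower {M : ℕ} (hM : 37 ≤ M) :
    1 - (1 - pcOriented) ^ (2 / (M : ℝ)) < 1 / (2 * √(2 * (M : ℝ) + 1)) := by
  have hM' : (37 : ℝ) ≤ M := by exact_mod_cast hM
  have hpc := pcOriented_le
  have hL := Real.log_three_lt_d9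
  have hL0 : 0 < Real.log 3 := Real.log_pos (by norm_num)
  set ℓ := Real.log 3
  set w := √(2 * (M : ℝ) + 1) with hw
  have hw2 : w ^ 2 = 2 * M + 1 := Real.sq_sqrt (by positivity)
  have hw0 : (8.6602 : ℝ) ≤ w := Real.le_sqrt_of_sq_le (by norm_num; linarith)
  have h1 : Real.exp (-(2 * ℓ / M)) ≤ (1 - pcOriented) ^ (2 / (M : ℝ)) := by
    refine le_trans (le_of_eq ?_) (Real.rpow_le_rpow (x := 1 / 3) (by norm_num) (by linarith)
      (by positivity))
    rw [Real.rpow_def_of_pos (by norm_num), one_div, Real.log_inv]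
    congr 1
    ring
  have h2 := one_sub_exp_neg_le (x := 2 * ℓ / M) (by positivity)
  have h3 : 2 * (2 * ℓ / M) / (2 + 2 * ℓ / M) = 2 * ℓ / (M + ℓ) := by
    field_simp
  have h4 : 2 * ℓ / (M + ℓ) < 1 / (2 * w) := by
    rw [div_lt_div_iff₀ (by linarith) (by linarith)]
    nlinarith
  linarith

end OrientedPercolation

theorem theorem1p1 :
    (∀ M : ℕ, 2 ≤ M →
      1 / (2 * Real.sqrt (2 * (M : ℝ) + 1)) ≤
        OrientedPercolation.pc (OrientedPercolation.exampleDir M) (-OrientedPercolation.e₂)) ∧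
    (∀ M : ℕ, 5 ≤ M →
      OrientedPercolation.pc (OrientedPercolation.exampleDir M) OrientedPercolation.e₂ ≤
          1 - (1 - OrientedPercolation.pcOriented) ^ (2 / (M : ℝ)) ∧
        1 - (1 - OrientedPercolation.pcOriented) ^ (2 / (M : ℝ)) <
          -2 * Real.log (1 - OrientedPercolation.pcOriented) / (M : ℝ) ∧
        -2 * Real.log (1 - OrientedPercolation.pcOriented) / (M : ℝ) ≤
          2 * Real.log 3 / (M : ℝ)) ∧
    (∀ M : ℕ, 37 ≤ M →
      OrientedPercolation.pc (OrientedPercolation.exampleDir M) OrientedPercolation.e₂ <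
        OrientedPercolation.pc (OrientedPercolation.exampleDir M) (-OrientedPercolation.e₂)) := by
  have hpc := OrientedPercolation.pcOriented_le
  have hpc' := OrientedPercolation.half_le_pcOriented
  refine ⟨fun M hM => OrientedPercolation.le_pc_neg M (by omega), fun M hM =>
    ⟨OrientedPercolation.pc_e₂_le (by omega), ?_, ?_⟩, fun M hM =>
    ((OrientedPercolation.pc_e₂_le (by omega)).trans_lt
      (OrientedPercolation.upper_lt_lower hM)).trans_le (OrientedPercolation.le_pc_neg M (by omega))⟩
  · have hM0 : (0 : ℝ) < M := by exact_mod_cast (by omega : 0 < M)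
    have hlog : Real.log (1 - OrientedPercolation.pcOriented) < 0 :=
      Real.log_neg (by linarith) (by linarith)
    -- Strictness comes from 1 + y < e^y for y ≠ 0. Here the logarithm is nonzero because the
    -- quadrant's critical value is positive.
    have h := Real.add_one_lt_exp (x := Real.log (1 - OrientedPercolation.pcOriented) * (2 / M))
      (mul_neg_of_neg_of_pos hlog (by positivity)).ne
    rw [Real.rpow_def_of_pos (by linarith)]
    rw [show -2 * Real.log (1 - OrientedPercolation.pcOriented) / (M : ℝ) =
      -(Real.log (1 - OrientedPercolation.pcOriented) * (2 / M)) by ring]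
    linarith
  · have h := Real.log_le_log (x := 1 / 3) (by norm_num)
      (by linarith : 1 / 3 ≤ 1 - OrientedPercolation.pcOriented)
    rw [one_div, Real.log_inv] at h
    gcongr ?_ / _
    linarith
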